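/- Throughout, $\rho\ge 1$ is an integer, $a\in[0,\rho)$, and $\phi:\mathbb R\to\mathbb C$. The shift-invariant space is $$V(\phi)=\Big\{f\in L^2(\mathbb R): f(x)=\sum_{k\in\mathbb Z}c_k\phi(x-k)\ (x\in\mathbb R)\text{ for some }(c_k)\in\ell^2(\mathbb Z)\Big\}.$$ The function $\phi\in L^2(\mathbb R)$ is a stable generator if $\{\phi(\cdot-n)\}_{n\in\mathbb Z}$ is a Riesz basis of $V(\phi)$, i.e. its closed linear span in $L^2(\mathbb R)$ is $V(\phi)$ and there are $0<A\le B<\infty$ with $A\sum|d_n|^2\le\|\sum d_n\phi(\cdot-n)\|_2^2\le B\sum|d_n|^2$ for all $(d_n)\in\ell^2(\mathbb Z)$. It is an $r$-regular stable generator if moreover $\phi\in C^r(\mathbb R)$ and, for some $\epsilon>0$, $\phi^{(s)}(t)=O(|t|^{-1/2-\epsilon})$ as $t\to\pm\infty$ for $s=0,\dots,r$. A set $\{x_n\}_{n\in\mathbb Z}\subset\mathbb R$ is, for $V(\phi)$ and order $\rho-1$, a *stable sampling set* if there are $A,B>0$ with $A\|f\|_2^2\le\sum_n\sum_{i=0}^{\rho-1}|f^{(i)}(x_n)|^2\le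 B\|f\|_2^2$ for all $f\in V(\phi)$; a *uniqueness set* if $f\in V(\phi)$ and $f^{(i)}(x_n)=0$ for all $n\in\mathbb Z$, $0\le i\le\rho-1$, imply $f=0$; an *interpolation set* if for every square summable $(c_{ni})$ some $f\in V(\phi)$ has $f^{(i)}(x_n)=c_{ni}$ for all $n\in\mathbb Z$, $0\le i\le\rho-1$; and a *complete interpolation set* if it is both a uniqueness set and an interpolation set. Let $U_\kappa$, $\kappa=(\phi,a,\rho)$, be the $\rho\times\rho$ block matrix with blocks $U_\kappa^{ij}=[\phi^{(i)}(a+\rho(l-k)-j)]_{l,k\in\mathbb Z}$, $0\le i,j\le\rho-1$. It is called a *block Laurent operator* if it is the matrix of a bounded operator on $\ell^2(\mathbb Z)^\rho$ (its blocks are constant along diagonals), and *invertible* if that operator has a bounded inverse. Let $\Psi_\kappa=[\Psi_\kappa^{ij}]$ with $\Psi_\kappa^{ij}(t)=\sum_{k\in\mathbb Z}\phi^{(i)}(a+\rho k-j)e^{2\pi\mathrm i kt}$, the series converging in $L^2[0,1]$. For a function $g$ on $[0,1]$ let $\widehat g(v)=\int_0^1g(t)e^{-2\pi\mathrm i vt}\,dt$.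 **Theorem.** Let $\phi$ be a $(\rho-1)$-regular stable generator, and consider the conditions (i) $a+\rho\mathbb Z$ is a stable sampling set of order $\rho-1$ for $V(\phi)$; (ii) $U_\kappa$ is an invertible block Laurent operator on $\ell^2(\mathbb Z)^\rho$; (iii) there are $m,M>0$ with $m\le|\det\Psi_\kappa(t)|\le M$ for a.e. $t\in[0,1]$; (iv) $a+\rho\mathbb Z$ is a complete interpolation set of order $\rho-1$ for $V(\phi)$. Then (i) and (ii) are equivalent, and if $U_\kappa$ is a block Laurent operator (i.e. bounded on $\ell^2(\mathbb Z)^\rho$), then (i), (ii), (iii) and (iv) are all equivalent. If (i) holds, then the entries of $\Psi_\kappa^{-1}$ (which exists for a.e. $t$) are integrable, for every $i$ and $t$ the series $$\Theta_{i,\kappa}(t)=\sum_{v\in\mathbb Z}\sum_{j=0}^{\rho-1}\widehat{(\Psi_\kappa^{-1})^{ji}}(v)\,\phi(t-\rho v-j)$$ is absolutely convergent in $v$, and for every $f\in V(\phi)$ and every $t\in\mathbb R$, with absolute convergence in $l$, $$f(t)=\sum_{l\in\mathbb Z}\sum_{i=0}^{\rho-1}f^{(i)}(a+\rho l)\,\Theta_{i,\kappa}(t-\rho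 l).$$ -/

import Mathlib

open MeasureTheory Filter Asymptotics
open scoped ENNReal NNReal

noncomputable section

namespace DerivSampling

/-- `ℓ²(ℤ)`. -/
abbrev SeqL2 : Type := lp (fun _ : ℤ => ℂ) 2

/-- `ℓ²(ℤ)^ρ`: square summable families indexed by the block number and the position in
the block, with norm `‖c‖² = ∑ j, ∑ k, |c (j, k)|²`. -/
abbrev BlockSeqL2 (ρ : ℕ) : Type := lp (fun _ : Fin ρ × ℤ => ℂ) 2

/-- The shift-invariant space `V(φ)`, as a space of functions on the line: all `f ∈ L²(ℝ)` with
`f(x) = ∑ₖ cₖ φ(x - k)` for every `x`, for some `(cₖ) ∈ ℓ²(ℤ)`. -/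
def shiftInvariantSpace (φ : ℝ → ℂ) : Set (ℝ → ℂ) :=
  {f | MemLp f 2 volume ∧ ∃ c : SeqL2, ∀ x : ℝ, HasSum (fun k : ℤ => c k * φ (x - k)) (f x)}

theorem memLp_translate {φ : ℝ → ℂ} (h : MemLp φ 2 volume) (n : ℤ) :
    MemLp (fun x : ℝ => φ (x - n)) 2 volume :=
  h.comp_measurePreserving (measurePreserving_sub_right volume (n : ℝ))

/-- The translate `φ(· - n)` as an element of `L²(ℝ)`. -/
def translateLp {φ : ℝ → ℂ} (h : MemLp φ 2 volume) (n : ℤ) : Lp ℂ 2 (volume : Measure ℝ) :=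
  (memLp_translate h n).toLp _

/-- `φ` is a stable generator: its integer translates form a Riesz basis of `V(φ)`, that is, the
closed linear span of the translates in `L²(ℝ)` is `V(φ)`, and for all `d ∈ ℓ²(ℤ)` the series
`∑ dₙ φ(· - n)` converges in `L²(ℝ)`, with
`A ∑ |dₙ|² ≤ ‖∑ dₙ φ(· - n)‖² ≤ B ∑ |dₙ|²`. -/
def IsStableGenerator (φ : ℝ → ℂ) : Prop :=
  ∃ h : MemLp φ 2 volume,
    ((Submodule.span ℂ (Set.range (translateLp h))).topologicalClosure :
        Set (Lp ℂ 2 (volume : Measure ℝ))) =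
      {F : Lp ℂ 2 (volume : Measure ℝ) | ∃ f ∈ shiftInvariantSpace φ, ⇑F =ᵐ[volume] f} ∧
    ∃ A B : ℝ, 0 < A ∧ A ≤ B ∧ ∀ d : SeqL2, ∃ F : Lp ℂ 2 (volume : Measure ℝ),
      HasSum (fun n : ℤ => d n • translateLp h n) F ∧
      A * ∑' n : ℤ, ‖d n‖ ^ 2 ≤ ‖F‖ ^ 2 ∧ ‖F‖ ^ 2 ≤ B * ∑' n : ℤ, ‖d n‖ ^ 2

/-- `φ` is an `r`-regular stable generator: it is a stable generator, it is `r` times continuously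
differentiable, and for some `ε > 0`, `φ⁽ˢ⁾(t) = O(|t| ^ (-1/2 - ε))` as `t → ±∞`, for all
`s ≤ r`. -/
structure IsRegularStableGenerator (r : ℕ) (φ : ℝ → ℂ) : Prop where
  stable : IsStableGenerator φ
  contDiff : ContDiff ℝ r φ
  decay : ∃ ε : ℝ, 0 < ε ∧ ∀ s : ℕ, s ≤ r →
    (iteratedDeriv s φ =O[atTop] fun t : ℝ => |t| ^ (-(1 / 2 : ℝ) - ε)) ∧
    (iteratedDeriv s φ =O[atBot] fun t : ℝ => |t| ^ (-(1 / 2 : ℝ) - ε))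

/-- `{xₙ}` is a set of uniqueness of order `r` for `V(φ)`. -/
def IsUniquenessSet (φ : ℝ → ℂ) (r : ℕ) (x : ℤ → ℝ) : Prop :=
  ∀ f ∈ shiftInvariantSpace φ,
    (∀ n : ℤ, ∀ i : ℕ, i ≤ r → iteratedDeriv i f (x n) = 0) → f = 0

/-- `{xₙ}` is a set of stable sampling of order `r` for `V(φ)`. The sum is taken in `[0, ∞]`, so
that its finiteness is part of the upper bound. -/
def IsStableSamplingSet (φ : ℝ → ℂ) (r : ℕ) (x : ℤ → ℝ) : Prop :=
  ∃ A B : ℝ≥0, 0 < A ∧ 0 < B ∧ ∀ f ∈ shiftInvariantSpace φ,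
    (A : ℝ≥0∞) * eLpNorm f 2 volume ^ 2
        ≤ ∑' n : ℤ, ∑ i ∈ Finset.range (r + 1), ‖iteratedDeriv i f (x n)‖ₑ ^ 2 ∧
    ∑' n : ℤ, ∑ i ∈ Finset.range (r + 1), ‖iteratedDeriv i f (x n)‖ₑ ^ 2
        ≤ (B : ℝ≥0∞) * eLpNorm f 2 volume ^ 2

/-- `{xₙ}` is a set of interpolation of order `r` for `V(φ)`. -/
def IsInterpolationSet (φ : ℝ → ℂ) (r : ℕ) (x : ℤ → ℝ) : Prop :=
  ∀ c : ℤ × Fin (r + 1) → ℂ, Summable (fun p => ‖c p‖ ^ 2) →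
    ∃ f ∈ shiftInvariantSpace φ,
      ∀ (n : ℤ) (i : Fin (r + 1)), iteratedDeriv (i : ℕ) f (x n) = c (n, i)

/-- `{xₙ}` is a complete interpolation set of order `r` for `V(φ)`. -/
def IsCompleteInterpolationSet (φ : ℝ → ℂ) (r : ℕ) (x : ℤ → ℝ) : Prop :=
  IsUniquenessSet φ r x ∧ IsInterpolationSet φ r x

/-- The sample points `a + ρ l`, `l ∈ ℤ`. -/
def samplePoints (a : ℝ) (ρ : ℕ) (l : ℤ) : ℝ := a + ρ * l

/-- The matrix of the bounded operator `T` on `ℓ²(ℤ)^ρ` with respect to the standard basis is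
`L`. Its blocks are `L_{ij} = [L (i, l) (j, k)]_{l, k}`. -/
def HasMatrix {ρ : ℕ} (T : BlockSeqL2 ρ →L[ℂ] BlockSeqL2 ρ)
    (L : Matrix (Fin ρ × ℤ) (Fin ρ × ℤ) ℂ) : Prop :=
  ∀ p q : Fin ρ × ℤ, T (lp.single 2 q (1 : ℂ)) p = L p q

/-- `L` is a block Laurent operator on `ℓ²(ℤ)^ρ`: every block is invariant under simultaneous
shifts of rows and columns, and `L` is the matrix of a bounded operator. -/
def IsBlockLaurent {ρ : ℕ} (L : Matrix (Fin ρ × ℤ) (Fin ρ × ℤ) ℂ) : Prop :=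
  (∀ (i j : Fin ρ) (l k n : ℤ), L (i, l - n) (j, k - n) = L (i, l) (j, k)) ∧
  ∃ T : BlockSeqL2 ρ →L[ℂ] BlockSeqL2 ρ, HasMatrix T L

/-- `L` is a block Laurent operator on `ℓ²(ℤ)^ρ` which has a bounded inverse. -/
def IsInvertibleBlockLaurent {ρ : ℕ} (L : Matrix (Fin ρ × ℤ) (Fin ρ × ℤ) ℂ) : Prop :=
  IsBlockLaurent L ∧ ∃ T : BlockSeqL2 ρ →L[ℂ] BlockSeqL2 ρ, HasMatrix T L ∧ IsUnit T

/-- The matrix `U_κ`, `κ = (φ, a, ρ)`: its `(i, j)` block is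
`[φ⁽ⁱ⁾(a + ρ (l - k) - j)]_{l, k ∈ ℤ}`. -/
def samplingMatrix (φ : ℝ → ℂ) (a : ℝ) (ρ : ℕ) : Matrix (Fin ρ × ℤ) (Fin ρ × ℤ) ℂ :=
  fun p q => iteratedDeriv (p.1 : ℕ) φ (a + ρ * ((p.2 : ℝ) - (q.2 : ℝ)) - ((q.1 : ℕ) : ℝ))

/-- The entry `Ψ_κ^{ij} = ∑ₖ φ⁽ⁱ⁾(a + ρ k - j) e^{2πikt}`. For a regular generator the coefficients
are square summable, and the series converges in `L²` of the circle `ℝ/ℤ`. -/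
def symbolEntry (φ : ℝ → ℂ) (a : ℝ) (ρ : ℕ) (i j : Fin ρ) :
    Lp ℂ 2 (AddCircle.haarAddCircle : Measure UnitAddCircle) :=
  ∑' k : ℤ, iteratedDeriv (i : ℕ) φ (a + ρ * (k : ℝ) - ((j : ℕ) : ℝ)) • fourierLp 2 k

/-- The matrix `Ψ_κ(t)`, defined for almost every `t ∈ ℝ/ℤ`. -/
def symbol (φ : ℝ → ℂ) (a : ℝ) (ρ : ℕ) (t : UnitAddCircle) : Matrix (Fin ρ) (Fin ρ) ℂ :=
  Matrix.of fun i j => symbolEntry φ a ρ i j t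

/-- `|det Ψ_κ(t)|` is bounded above and away from zero, for almost every `t`. -/
def SymbolDetBounded (φ : ℝ → ℂ) (a : ℝ) (ρ : ℕ) : Prop :=
  ∃ m M : ℝ, 0 < m ∧ 0 < M ∧
    ∀ᵐ t ∂(AddCircle.haarAddCircle : Measure UnitAddCircle),
      m ≤ ‖(symbol φ a ρ t).det‖ ∧ ‖(symbol φ a ρ t).det‖ ≤ M

/-- The `v`-th term of the series of `Θ_{i,κ}(t)`, namely
`∑ⱼ ((Ψ_κ⁻¹)^{ji})^(v) φ(t - ρ v - j)`, with the `v`-th Fourier coefficient of `(Ψ_κ⁻¹)^{ji}`. -/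
def reconstructionTerm (φ : ℝ → ℂ) (a : ℝ) (ρ : ℕ) (i : Fin ρ) (t : ℝ) (v : ℤ) : ℂ :=
  ∑ j : Fin ρ, fourierCoeff (fun s : UnitAddCircle => (symbol φ a ρ s)⁻¹ j i) v *
    φ (t - ρ * (v : ℝ) - ((j : ℕ) : ℝ))

/-- The reconstruction function `Θ_{i,κ}`. -/
def reconstructionFun (φ : ℝ → ℂ) (a : ℝ) (ρ : ℕ) (i : Fin ρ) (t : ℝ) : ℂ :=
  ∑' v : ℤ, reconstructionTerm φ a ρ i t v

end DerivSampling

end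

open DerivSampling MeasureTheory

noncomputable section

namespace DerivSampling

/-! ### Square summable families -/

section SquareSummable

variable {α β : Type*}

/-! By the Riesz bounds, synthesis `blockSynth` identifies ℓ²(ℤ)^ρ with V(φ) up to equivalent norms.
The decay exponent exceeds 1/2, so the translates of each φ⁽ˢ⁾ are square summable, locally
uniformly. Functions in V(φ) may then be differentiated term by term, and the samples of `blockSynth
φ c` are the entries of U_κ c (`IsRegularStableGenerator.apply_eq_iteratedDeriv`). For bounded U_κ,
stable sampling thus means bounded below, and complete interpolation means bijective.

Fourier series turn U_κ into multiplication by the square matrix Ψ_κ(t)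
(`HasSymbol.blockFourier_apply`). Testing on v 1_E localises norm inequalities to almost every t, so
a lower bound for U_κ bounds |det Ψ_κ| from below (`HasSymbol.exists_le_norm_det`). Conversely,
Cramer's rule then gives Ψ_κ⁻¹ bounded entries, and multiplication by it inverts U_κ
(`HasSymbol.isUnit`). Since Ψ_κ(t) is a finite square matrix, bounded below already implies onto.
Boundedness of U_κ is part of (ii), and under (i) it follows from the upper sampling inequality
(`IsRegularStableGenerator.exists_hasMatrix`).

For the formula, U_κ⁻¹ has the Fourier coefficients of Ψ_κ⁻¹ as entries, so Θ_{i,κ}(· - ρl) is the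
synthesis of one of its columns. Expanding the samples in the standard basis and applying U_κ⁻¹,
then evaluation at t, gives the series. -/

theorem summable_norm_sq_lp (c : lp (fun _ : α => ℂ) 2) : Summable fun x => ‖c x‖ ^ 2 := by
  simpa using (lp.memℓp c).summable (by norm_num)

theorem norm_sq_eq_tsum_lp (c : lp (fun _ : α => ℂ) 2) : ‖c‖ ^ 2 = ∑' x, ‖c x‖ ^ 2 := by
  simpa using lp.norm_rpow_eq_tsum (p := 2) (by norm_num) c

/-- A square summable family, as an element of `ℓ²`. -/
def lpOfSummable (c : α → ℂ) (h : Summable fun x => ‖c x‖ ^ 2) : lp (fun _ : α => ℂ) 2 :=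
  ⟨c, memℓp_gen (by simpa using h)⟩

@[simp]
theorem lpOfSummable_apply (c : α → ℂ) (h : Summable fun x => ‖c x‖ ^ 2) (x : α) :
    lpOfSummable c h x = c x := rfl

theorem lp_single_apply_eq_ite [DecidableEq α] (x y : α) (z : ℂ) :
    (lp.single 2 x z : lp (fun _ : α => ℂ) 2) y = if y = x then z else 0 := by
  by_cases h : y = x
  · subst h; simp
  · simp [h]

/-- Composition with an injective map of the index sets, as a contraction of `ℓ²` spaces. -/
def lpComp (e : α → β) (he : Function.Injective e) :
    lp (fun _ : β => ℂ) 2 →L[ℂ] lp (fun _ : α => ℂ) 2 :=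
  LinearMap.mkContinuous
    { toFun := fun c => lpOfSummable (fun x => c (e x)) ((summable_norm_sq_lp c).comp_injective he)
      map_add' := fun _ _ => rfl
      map_smul' := fun _ _ => rfl } 1 fun c => by
    rw [one_mul]
    refine le_of_sq_le_sq ?_ (norm_nonneg _)
    rw [norm_sq_eq_tsum_lp, norm_sq_eq_tsum_lp]
    exact tsum_comp_le_tsum_of_inj (summable_norm_sq_lp c) (fun _ => by positivity) he

@[simp]
theorem lpComp_apply (e : α → β) (he : Function.Injective e) (c : lp (fun _ : β => ℂ) 2) (x : α) :
    lpComp e he c x = c (e x) := rfl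

theorem norm_lpComp_equiv (e : α ≃ β) (c : lp (fun _ : β => ℂ) 2) :
    ‖lpComp e e.injective c‖ = ‖c‖ := by
  refine (sq_eq_sq₀ (norm_nonneg _) (norm_nonneg _)).1 ?_
  rw [norm_sq_eq_tsum_lp, norm_sq_eq_tsum_lp]
  exact e.tsum_eq fun x => ‖c x‖ ^ 2

theorem summable_mul_of_summable_sq {c d : α → ℂ} (hc : Summable fun x => ‖c x‖ ^ 2)
    (hd : Summable fun x => ‖d x‖ ^ 2) : Summable fun x => c x * d x := by
  refine Summable.of_norm_bounded (hc.add hd) fun x => ?_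
  rw [norm_mul]
  nlinarith [sq_nonneg (‖c x‖ - ‖d x‖), sq_nonneg (‖c x‖), sq_nonneg (‖d x‖)]

/-- The functional `c ↦ ∑ cₓ dₓ` on `ℓ²`. -/
def lpPairingCLM (d : α → ℂ) (hd : Summable fun x => ‖d x‖ ^ 2) :
    lp (fun _ : α => ℂ) 2 →L[ℂ] ℂ :=
  innerSL ℂ (lpOfSummable (fun x => star (d x)) (by simpa using hd))

theorem hasSum_lpPairingCLM (d : α → ℂ) (hd : Summable fun x => ‖d x‖ ^ 2)
    (c : lp (fun _ : α => ℂ) 2) : HasSum (fun x => c x * d x) (lpPairingCLM d hd c) := by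
  have := lp.hasSum_inner (𝕜 := ℂ) (lpOfSummable (fun x => star (d x)) (by simpa using hd)) c
  simpa [lpPairingCLM] using this

/-- A bounded operator is determined by its columns. This yields both the action of the sampling
matrix by row sums and, at the end, the sampling series. -/
theorem hasSum_apply_single [DecidableEq α] {E : Type*} [NormedAddCommGroup E] [NormedSpace ℂ E]
    (T : lp (fun _ : α => ℂ) 2 →L[ℂ] E) (c : lp (fun _ : α => ℂ) 2) :
    HasSum (fun x => c x • T (lp.single 2 x 1)) (T c) := by
  have := (lp.hasSum_single (by simp) c).mapL T
  simpa only [Function.comp_apply, ← map_smul, ← lp.single_smul, smul_eq_mul, mul_one] using this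

end SquareSummable

/-! ### The Fourier transform of block sequences -/

section BlockFourier

/-- `L²(ℝ/ℤ)`. -/
abbrev CircleL2 : Type := Lp ℂ 2 (AddCircle.haarAddCircle : Measure UnitAddCircle)

variable {ρ : ℕ}

/-- The function `∑ₖ c (j, k) e^{2πikt}` in `L²(ℝ/ℤ)`. -/
def blockFourier (j : Fin ρ) : BlockSeqL2 ρ →L[ℂ] CircleL2 :=
  (fourierBasis (T := 1)).repr.symm.toContinuousLinearEquiv.toContinuousLinearMap ∘L
    lpComp (fun k : ℤ => (j, k)) (fun _ _ h => (Prod.mk.inj h).2)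

theorem fourierCoeff_blockFourier (j : Fin ρ) (c : BlockSeqL2 ρ) (k : ℤ) :
    fourierCoeff (blockFourier j c) k = c (j, k) := by
  rw [← fourierBasis_repr]
  simp [blockFourier]
  rfl

theorem Lp_ext_fourierCoeff {f g : CircleL2} (h : ∀ k, fourierCoeff f k = fourierCoeff g k) :
    f = g := by
  apply (fourierBasis (T := 1)).repr.injective
  ext k
  simpa [fourierBasis_repr] using h k

theorem norm_sq_eq_sum_blockFourier (c : BlockSeqL2 ρ) :
    ‖c‖ ^ 2 = ∑ j, ‖blockFourier j c‖ ^ 2 := by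
  have h : ∀ j, ‖blockFourier j c‖ ^ 2 = ∑' k, ‖c (j, k)‖ ^ 2 := fun j => by
    simp only [blockFourier, ContinuousLinearMap.comp_apply]
    rw [show ∀ x, ‖((fourierBasis (T := 1)).repr.symm.toContinuousLinearEquiv.toContinuousLinearMap)
      x‖ = ‖x‖ from fun x => (fourierBasis (T := 1)).repr.symm.norm_map x, norm_sq_eq_tsum_lp]
    rfl
  rw [norm_sq_eq_tsum_lp, (summable_norm_sq_lp c).tsum_prod, tsum_fintype]
  simp [h]

/-- Riesz–Fischer in each block; it allows test vectors and preimages to be built on the Fourier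
side. -/
theorem exists_blockFourier_eq (g : Fin ρ → CircleL2) :
    ∃ c : BlockSeqL2 ρ, ∀ j, blockFourier j c = g j := by
  have hs : Summable fun p : Fin ρ × ℤ => ‖fourierCoeff (g p.1) p.2‖ ^ 2 := by
    rw [summable_prod_of_nonneg fun _ => by positivity]
    exact ⟨fun j => (hasSum_sq_fourierCoeff (g j)).summable, (hasSum_fintype _).summable⟩
  exact ⟨lpOfSummable _ hs, fun j => Lp_ext_fourierCoeff fun k => fourierCoeff_blockFourier j _ k⟩

theorem blockFourier_ext {c d : BlockSeqL2 ρ} (h : ∀ j, blockFourier j c = blockFourier j d) :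
    c = d := by
  ext ⟨j, k⟩
  rw [← fourierCoeff_blockFourier, h, fourierCoeff_blockFourier]

theorem blockFourier_single (i j : Fin ρ) (k : ℤ) :
    blockFourier i (lp.single 2 (j, k) 1) = if i = j then fourierLp 2 k else 0 := by
  refine Lp_ext_fourierCoeff fun n => ?_
  rw [fourierCoeff_blockFourier, lp_single_apply_eq_ite, ← fourierBasis_repr]
  split_ifs with h1 h2 h2
  · obtain ⟨-, rfl⟩ := Prod.mk.inj h1
    rw [← coe_fourierBasis, HilbertBasis.repr_self]; simp
  · exact absurd (Prod.mk.inj h1).1 h2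
  · subst h2
    rw [← coe_fourierBasis, HilbertBasis.repr_self, lp_single_apply_eq_ite, if_neg]
    rintro rfl; exact h1 rfl
  · simp

end BlockFourier

/-! ### Block Laurent operators as multiplication operators -/

section Symbol

variable {ρ : ℕ}

theorem fourierCoeff_fourier_mul (f : UnitAddCircle → ℂ) (k n : ℤ) :
    fourierCoeff (fun t => fourier k t * f t) n = fourierCoeff f (n - k) := by
  unfold fourierCoeff
  congr 1
  ext t
  rw [show -(n - k) = -n + k by ring, fourier_add]
  simp [mul_assoc]

theorem memLp_fourier_mul (f : CircleL2) (k : ℤ) :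
    MemLp (fun t => fourier k t * f t) 2 (AddCircle.haarAddCircle : Measure UnitAddCircle) := by
  refine (Lp.memLp f).of_le ?_ (Eventually.of_forall fun t => ?_)
  · exact (fourier k).continuous.aestronglyMeasurable.mul (Lp.aestronglyMeasurable f)
  · simp only [norm_mul]
    rw [show ‖fourier k t‖ = 1 from by simp only [fourier_apply]; exact Circle.norm_coe _, one_mul]

/-- `T` is the block Laurent operator with symbol `Ψ`: its matrix entries are Fourier coefficients
of the entries of `Ψ`. -/
def HasSymbol (T : BlockSeqL2 ρ →L[ℂ] BlockSeqL2 ρ) (Ψ : Fin ρ → Fin ρ → CircleL2) : Prop :=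
  ∀ (i j : Fin ρ) (l k : ℤ), T (lp.single 2 (j, k) 1) (i, l) = fourierCoeff (Ψ i j) (l - k)

variable {T : BlockSeqL2 ρ →L[ℂ] BlockSeqL2 ρ} {Ψ : Fin ρ → Fin ρ → CircleL2}

/-- The matrix-valued function with entries `Ψ i j`. -/
def symbolMatrix (Ψ : Fin ρ → Fin ρ → CircleL2) (t : UnitAddCircle) : Matrix (Fin ρ) (Fin ρ) ℂ :=
  Matrix.of fun i j => Ψ i j t

theorem HasSymbol.blockFourier_single (h : HasSymbol T Ψ) (i j : Fin ρ) (k : ℤ) :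
    blockFourier i (T (lp.single 2 (j, k) 1))
      =ᵐ[AddCircle.haarAddCircle] fun t => fourier k t * Ψ i j t := by
  have : blockFourier i (T (lp.single 2 (j, k) 1)) = (memLp_fourier_mul (Ψ i j) k).toLp := by
    refine Lp_ext_fourierCoeff fun n => ?_
    rw [fourierCoeff_blockFourier, h, fourierCoeff_congr_ae (MemLp.coeFn_toLp _),
      fourierCoeff_fourier_mul]
  rw [this]
  exact MemLp.coeFn_toLp _

/-- Multiplication by an entry known only to be in L² maps L² continuously into L¹. Both sides are
therefore continuous maps from ℓ² to L¹, and it suffices to compare them on basis vectors. -/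
theorem HasSymbol.blockFourier_apply (h : HasSymbol T Ψ) (c : BlockSeqL2 ρ) (i : Fin ρ) :
    blockFourier i (T c)
      =ᵐ[AddCircle.haarAddCircle] fun t => ∑ j, Ψ i j t * blockFourier j c t := by
  let M := (ContinuousLinearMap.mul ℂ ℂ).holderL
    (AddCircle.haarAddCircle : Measure UnitAddCircle) 2 2 1
  have hM : ∀ f g : CircleL2, M f g =ᵐ[AddCircle.haarAddCircle] fun t => f t * g t :=
    fun f g => (ContinuousLinearMap.mul ℂ ℂ).coeFn_holder f g
  have hsum : ∀ c, (∑ j, M (Ψ i j) (blockFourier j c) : Lp ℂ 1 _)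
      =ᵐ[AddCircle.haarAddCircle] fun t => ∑ j, Ψ i j t * blockFourier j c t := fun c => by
    have h1 := Lp.coeFn_fun_finsetSum (p := 1) Finset.univ fun j => M (Ψ i j) (blockFourier j c)
    filter_upwards [h1, ae_all_iff.2 fun j => hM (Ψ i j) (blockFourier j c)] with t ht1 ht2
    rw [ht1]
    exact Finset.sum_congr rfl fun j _ => ht2 j
  -- Multiplying by the constant function 1 = `fourierLp 2 0` embeds L² in L¹.
  have hone : ∀ f : CircleL2, M (fourierLp 2 0) f =ᵐ[AddCircle.haarAddCircle] f := fun f => by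
    filter_upwards [hM (fourierLp 2 0) f, coeFn_fourierLp (T := 1) 2 0] with t ht1 ht2
    rw [ht1, ht2, fourier_zero, one_mul]
  have key : (M (fourierLp 2 0) ∘L blockFourier i ∘L T) =
      ∑ j, (M (Ψ i j) ∘L blockFourier j) := by
    refine lp.ext_continuousLinearMap (by simp) fun ⟨j, k⟩ => ?_
    ext1
    refine Lp.ext ?_
    simp only [ContinuousLinearMap.comp_apply, _root_.sum_apply,
      lp.singleContinuousLinearMap_apply]
    filter_upwards [hone (blockFourier i (T (lp.single 2 (j, k) 1))), hsum (lp.single 2 (j, k) 1),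
      h.blockFourier_single i j k, coeFn_fourierLp (T := 1) 2 k,
      Lp.coeFn_zero ℂ 2 (AddCircle.haarAddCircle : Measure UnitAddCircle)] with t h1 h2 h3 h4 h5
    rw [h1, h2, h3, Finset.sum_eq_single j]
    · rw [DerivSampling.blockFourier_single, if_pos rfl, h4, mul_comm]
    · intro j' _ hj
      rw [DerivSampling.blockFourier_single, if_neg hj, h5]; simp
    · simp
  have := DFunLike.congr_fun key c
  simp only [ContinuousLinearMap.comp_apply, _root_.sum_apply] at this
  filter_upwards [hone (blockFourier i (T c)), hsum c] with t h1 h2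
  rw [← h1, this, h2]

/-- The vector of block Fourier transforms of `T c` is `Ψ` times that of `c`. -/
theorem HasSymbol.blockFourier_mulVec (h : HasSymbol T Ψ) (c : BlockSeqL2 ρ) :
    ∀ᵐ t ∂AddCircle.haarAddCircle, (fun i => blockFourier i (T c) t) =
      (symbolMatrix Ψ t).mulVec fun j => blockFourier j c t := by
  filter_upwards [ae_all_iff.2 fun i => h.blockFourier_apply c i] with t ht
  ext i
  rw [ht]
  rfl

theorem norm_sq_eq_integral (f : CircleL2) :
    ‖f‖ ^ 2 = ∫ t, ‖f t‖ ^ 2 ∂AddCircle.haarAddCircle := by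
  have := tsum_sq_fourierCoeff (T := 1) f
  rw [← this, ← (fourierBasis (T := 1)).repr.norm_map, norm_sq_eq_tsum_lp]
  simp only [fourierBasis_repr]

/-- `‖Ψ(t) v‖²`, for the Euclidean norm. -/
def symbolNormSq (Ψ : Fin ρ → Fin ρ → CircleL2) (v : Fin ρ → ℂ) (t : UnitAddCircle) : ℝ :=
  ∑ i, ‖(symbolMatrix Ψ t).mulVec v i‖ ^ 2

theorem integrable_norm_sq_mulVec (Ψ : Fin ρ → Fin ρ → CircleL2) (v : Fin ρ → ℂ) (i : Fin ρ) :
    Integrable (fun t => ‖(symbolMatrix Ψ t).mulVec v i‖ ^ 2) AddCircle.haarAddCircle := by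
  have : MemLp (fun t => ∑ j, Ψ i j t * v j) 2
      (AddCircle.haarAddCircle : Measure UnitAddCircle) :=
    memLp_finsetSum _ fun j _ => (Lp.memLp (Ψ i j)).mul_const (v j)
  exact (memLp_two_iff_integrable_sq_norm this.aestronglyMeasurable).1 this

theorem integrable_symbolNormSq (Ψ : Fin ρ → Fin ρ → CircleL2) (v : Fin ρ → ℂ) :
    Integrable (symbolNormSq Ψ v) AddCircle.haarAddCircle :=
  integrable_finsetSum _ fun i _ => integrable_norm_sq_mulVec Ψ v i

/-- Testing `T` on the vector `v 1_E`. -/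
theorem HasSymbol.exists_test (h : HasSymbol T Ψ) (v : Fin ρ → ℂ) {E : Set UnitAddCircle}
    (hE : MeasurableSet E) : ∃ c : BlockSeqL2 ρ,
      ‖c‖ ^ 2 = ∫ _ in E, (∑ j, ‖v j‖ ^ 2) ∂AddCircle.haarAddCircle ∧
      ‖T c‖ ^ 2 = ∫ t in E, symbolNormSq Ψ v t ∂AddCircle.haarAddCircle := by
  obtain ⟨c, hc⟩ := exists_blockFourier_eq fun j =>
    indicatorConstLp 2 (μ := (AddCircle.haarAddCircle : Measure UnitAddCircle)) hE
      (measure_ne_top _ _) (v j)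
  have hind : ∀ᵐ t ∂AddCircle.haarAddCircle, ∀ j, blockFourier j c t = E.indicator (fun _ => v j) t :=
    ae_all_iff.2 fun j => by rw [hc]; exact indicatorConstLp_coeFn
  refine ⟨c, ?_, ?_⟩
  · rw [norm_sq_eq_sum_blockFourier, integral_finsetSum _ fun j _ => integrable_const _]
    refine Finset.sum_congr rfl fun j _ => ?_
    rw [norm_sq_eq_integral, ← integral_indicator hE]
    refine integral_congr_ae ?_
    filter_upwards [hind] with t ht
    rw [ht]
    by_cases hmem : t ∈ E <;> simp [hmem]
  · rw [norm_sq_eq_sum_blockFourier]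
    unfold symbolNormSq
    rw [integral_finsetSum _ fun j _ => (integrable_norm_sq_mulVec Ψ v j).integrableOn]
    refine Finset.sum_congr rfl fun i _ => ?_
    rw [norm_sq_eq_integral, ← integral_indicator hE]
    refine integral_congr_ae ?_
    filter_upwards [hind, h.blockFourier_mulVec c] with t ht ht'
    rw [congr_fun ht' i]
    by_cases hmem : t ∈ E
    · simp [hmem, ht]
    · simp only [ht, hmem, not_false_eq_true, Set.indicator_of_notMem]
      rw [show (fun _ : Fin ρ => (0 : ℂ)) = 0 from rfl, Matrix.mulVec_zero]
      simp

/-- Testing on the j-th unit vector times 1_E bounds the integral of the squared norm of column j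
over every E, hence bounds it almost everywhere. -/
theorem HasSymbol.norm_entry_le (h : HasSymbol T Ψ) :
    ∀ᵐ t ∂AddCircle.haarAddCircle, ∀ i j, ‖symbolMatrix Ψ t i j‖ ≤ ‖T‖ := by
  refine (ae_all_iff.2 fun i => ae_all_iff.2 fun j => ?_)
  have : symbolNormSq Ψ (Pi.single j 1) ≤ᵐ[AddCircle.haarAddCircle]
      fun _ => ‖T‖ ^ 2 * ∑ j', ‖(Pi.single j 1 : Fin ρ → ℂ) j'‖ ^ 2 := by
    refine ae_le_of_forall_setIntegral_le (integrable_symbolNormSq _ _) (integrable_const _) ?_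
    intro E hE _
    obtain ⟨c, hc, hTc⟩ := h.exists_test (Pi.single j 1) hE
    rw [integral_const_mul, ← hc, ← hTc, ← mul_pow]
    exact pow_le_pow_left₀ (norm_nonneg _) (T.le_opNorm c) 2
  filter_upwards [this] with t ht
  refine le_of_sq_le_sq ?_ (norm_nonneg _)
  have h1 : ∑ j', ‖(Pi.single j 1 : Fin ρ → ℂ) j'‖ ^ 2 = 1 := by
    rw [Finset.sum_eq_single j] <;> simp +contextual
  rw [h1, mul_one] at ht
  refine le_trans ?_ ht
  have := Finset.single_le_sum (f := fun i => ‖(symbolMatrix Ψ t).mulVec (Pi.single j 1) i‖ ^ 2)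
    (fun i _ => by positivity) (Finset.mem_univ i)
  simpa [symbolNormSq] using this

theorem HasSymbol.le_symbolNormSq (h : HasSymbol T Ψ) {δ : ℝ} (hδ : 0 ≤ δ)
    (hT : ∀ c, δ * ‖c‖ ≤ ‖T c‖) :
    ∀ᵐ t ∂AddCircle.haarAddCircle, ∀ v : Fin ρ → ℂ,
      δ ^ 2 * ∑ j, ‖v j‖ ^ 2 ≤ symbolNormSq Ψ v t := by
  have hv : ∀ v : Fin ρ → ℂ, ∀ᵐ t ∂AddCircle.haarAddCircle,
      δ ^ 2 * ∑ j, ‖v j‖ ^ 2 ≤ symbolNormSq Ψ v t := fun v => by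
    refine ae_le_of_forall_setIntegral_le (integrable_const _) (integrable_symbolNormSq _ _) ?_
    intro E hE _
    obtain ⟨c, hc, hTc⟩ := h.exists_test v hE
    rw [integral_const_mul, ← hc, ← hTc, ← mul_pow]
    exact pow_le_pow_left₀ (by positivity) (hT c) 2
  -- The null set in `hv` depends on v. A countable dense set of vectors gives a common one, and
  -- continuity in v extends the inequality to all v.
  filter_upwards [ae_all_iff.2 fun n => hv (TopologicalSpace.denseSeq (Fin ρ → ℂ) n)] with t ht v
  refine DenseRange.induction_on (TopologicalSpace.denseRange_denseSeq (Fin ρ → ℂ)) v ?_ ht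
  refine isClosed_le (by fun_prop) ?_
  unfold symbolNormSq
  refine continuous_finsetSum _ fun i _ => Continuous.pow (Continuous.norm ?_) 2
  exact (continuous_apply i).comp (Continuous.matrix_mulVec continuous_const continuous_id)

theorem HasSymbol.exists_le_norm_det (h : HasSymbol T Ψ) {δ : ℝ} (hδ : 0 < δ)
    (hT : ∀ c, δ * ‖c‖ ≤ ‖T c‖) :
    ∃ m : ℝ, 0 < m ∧ ∀ᵐ t ∂AddCircle.haarAddCircle, m ≤ ‖(symbolMatrix Ψ t).det‖ := by
  -- The lower bound makes every entry of the inverse at most δ⁻¹, so the Leibniz expansion gives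
  -- |det A⁻¹| ≤ ρ! δ⁻ρ.
  refine ⟨(ρ.factorial * δ⁻¹ ^ ρ)⁻¹, by positivity, ?_⟩
  filter_upwards [h.le_symbolNormSq hδ.le hT] with t ht
  unfold symbolNormSq at ht
  set A := symbolMatrix Ψ t
  have hdet : A.det ≠ 0 := by
    intro h0
    obtain ⟨v, hv, hAv⟩ := Matrix.exists_mulVec_eq_zero_iff.2 h0
    have := ht v
    simp only [hAv, Pi.zero_apply, norm_zero] at this
    obtain ⟨j, hj⟩ := Function.ne_iff.1 hv
    have h1 := Finset.single_le_sum (f := fun j => ‖v j‖ ^ 2) (fun i _ => by positivity)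
      (Finset.mem_univ j)
    have h2 : 0 < ‖v j‖ ^ 2 := by have := norm_pos_iff.2 hj; positivity
    have h3 : 0 < δ ^ 2 * ∑ j, ‖v j‖ ^ 2 := mul_pos (by positivity) (h2.trans_le h1)
    simp at this
    linarith
  have hinv : ∀ j i, ‖A⁻¹ j i‖ ≤ δ⁻¹ := by
    intro j i
    have h0 := ht (A⁻¹.mulVec (Pi.single i 1))
    rw [Matrix.mulVec_mulVec, Matrix.mul_nonsing_inv _ (isUnit_iff_ne_zero.2 hdet),
      Matrix.one_mulVec] at h0
    have h1 : ∑ j', ‖(Pi.single i 1 : Fin ρ → ℂ) j'‖ ^ 2 = 1 := by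
      rw [Finset.sum_eq_single i] <;> simp +contextual
    rw [h1] at h0
    have h2 := Finset.single_le_sum (f := fun j => ‖A⁻¹.mulVec (Pi.single i 1) j‖ ^ 2)
      (fun i _ => by positivity) (Finset.mem_univ j)
    have h3 : δ ^ 2 * ‖A⁻¹ j i‖ ^ 2 ≤ 1 := by
      refine le_trans (mul_le_mul_of_nonneg_left ?_ (by positivity)) h0
      simpa using h2
    rw [inv_eq_one_div δ, le_div_iff₀ hδ]
    rw [← mul_pow] at h3
    have := abs_le_one_iff_mul_self_le_one.2 (by simpa [sq] using h3)
    rw [mul_comm]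
    exact (abs_le.1 this).2
  have hle : ‖A⁻¹.det‖ ≤ _ :=
    Matrix.det_le (A := A⁻¹) (abv := NormedField.toAbsoluteValue ℂ) (x := δ⁻¹) hinv
  have hle' : ‖A.det‖⁻¹ ≤ ρ.factorial * δ⁻¹ ^ ρ := by
    rw [← norm_inv]
    simpa [Matrix.det_nonsing_inv, nsmul_eq_mul] using hle
  have := inv_anti₀ (by positivity) hle'
  simpa using this

/-- An adjugate entry is the determinant of the matrix with one row replaced by a unit vector; the
maximum with 1 covers that row. -/
theorem norm_adjugate_le {A : Matrix (Fin ρ) (Fin ρ) ℂ} {K : ℝ} (hK : ∀ i j, ‖A i j‖ ≤ K)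
    (i j : Fin ρ) : ‖A.adjugate i j‖ ≤ ρ.factorial * (max K 1) ^ ρ := by
  rw [Matrix.adjugate_apply]
  have h : ∀ a b, ‖A.updateRow j (Pi.single i 1) a b‖ ≤ max K 1 := by
    intro a b
    rw [Matrix.updateRow_apply]
    split_ifs
    · by_cases hb : b = i
      · subst hb; simp
      · simp [hb]
    · exact (hK a b).trans (le_max_left _ _)
  have : ‖(A.updateRow j (Pi.single i 1)).det‖ ≤ _ :=
    Matrix.det_le (abv := NormedField.toAbsoluteValue ℂ) h
  simpa [nsmul_eq_mul] using this

/-- The inverse of the symbol, when the determinant is bounded away from zero, has bounded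
entries. -/
theorem HasSymbol.exists_norm_inv_le (h : HasSymbol T Ψ) {m : ℝ} (hm : 0 < m)
    (hdet : ∀ᵐ t ∂AddCircle.haarAddCircle, m ≤ ‖(symbolMatrix Ψ t).det‖) :
    ∃ K : ℝ, ∀ᵐ t ∂AddCircle.haarAddCircle, ∀ j i, ‖(symbolMatrix Ψ t)⁻¹ j i‖ ≤ K := by
  refine ⟨m⁻¹ * (ρ.factorial * (max ‖T‖ 1) ^ ρ), ?_⟩
  filter_upwards [hdet, h.norm_entry_le] with t h1 h2 j i
  rw [Matrix.inv_def, Ring.inverse_eq_inv', Matrix.smul_apply, norm_smul, norm_inv]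
  exact mul_le_mul (inv_anti₀ hm h1) (norm_adjugate_le h2 j i) (norm_nonneg _) (by positivity)

theorem aestronglyMeasurable_det {α : Type*} [MeasurableSpace α] {μ : Measure α}
    {A : α → Matrix (Fin ρ) (Fin ρ) ℂ} (hA : ∀ i j, AEStronglyMeasurable (fun t => A t i j) μ) :
    AEStronglyMeasurable (fun t => (A t).det) μ := by
  simp only [Matrix.det_apply]
  refine Finset.aestronglyMeasurable_fun_sum _ fun σ _ => ?_
  exact (Finset.aestronglyMeasurable_fun_prod _ fun i _ => hA _ _).const_smul _

theorem aestronglyMeasurable_inv_entry {α : Type*} [MeasurableSpace α] {μ : Measure α}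
    {A : α → Matrix (Fin ρ) (Fin ρ) ℂ} (hA : ∀ i j, AEStronglyMeasurable (fun t => A t i j) μ)
    (j i : Fin ρ) : AEStronglyMeasurable (fun t => (A t)⁻¹ j i) μ := by
  simp only [Matrix.inv_def, Ring.inverse_eq_inv', Matrix.smul_apply, Matrix.adjugate_apply,
    smul_eq_mul]
  refine AEStronglyMeasurable.mul ?_ (aestronglyMeasurable_det
    (A := fun t => (A t).updateRow i (Pi.single j 1)) fun a b => ?_)
  · exact (aestronglyMeasurable_det hA).aemeasurable.inv.aestronglyMeasurable
  · simp only [Matrix.updateRow_apply]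
    split_ifs
    · exact aestronglyMeasurable_const
    · exact hA a b

theorem aestronglyMeasurable_symbolMatrix_inv (Ψ : Fin ρ → Fin ρ → CircleL2) (j i : Fin ρ) :
    AEStronglyMeasurable (fun t => (symbolMatrix Ψ t)⁻¹ j i) AddCircle.haarAddCircle :=
  aestronglyMeasurable_inv_entry (fun i j => Lp.aestronglyMeasurable (Ψ i j)) j i

theorem HasSymbol.memLp_inv (h : HasSymbol T Ψ) {m : ℝ} (hm : 0 < m)
    (hdet : ∀ᵐ t ∂AddCircle.haarAddCircle, m ≤ ‖(symbolMatrix Ψ t).det‖) (j i : Fin ρ) :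
    MemLp (fun t => (symbolMatrix Ψ t)⁻¹ j i) ∞
      (AddCircle.haarAddCircle : Measure UnitAddCircle) := by
  obtain ⟨K, hK⟩ := h.exists_norm_inv_le hm hdet
  exact memLp_top_of_bound (aestronglyMeasurable_symbolMatrix_inv Ψ j i) K
    (hK.mono fun t ht => ht j i)

/-- Multiplying by the pointwise inverse matrix gives injectivity and surjectivity; the open mapping
theorem then makes the inverse bounded. -/
theorem HasSymbol.isUnit (h : HasSymbol T Ψ) {m : ℝ} (hm : 0 < m)
    (hdet : ∀ᵐ t ∂AddCircle.haarAddCircle, m ≤ ‖(symbolMatrix Ψ t).det‖) : IsUnit T := by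
  have hu : ∀ᵐ t ∂AddCircle.haarAddCircle, IsUnit (symbolMatrix Ψ t).det :=
    hdet.mono fun t ht => isUnit_iff_ne_zero.2 fun h0 => by simp [h0] at ht; linarith
  have hinj : Function.Injective T := by
    rw [injective_iff_map_eq_zero]
    intro c hc
    refine blockFourier_ext fun j => Lp.ext ?_
    have h0 : ∀ᵐ t ∂AddCircle.haarAddCircle, ∀ i, blockFourier i (T c) t = 0 :=
      ae_all_iff.2 fun i => by
        rw [hc, map_zero]; exact Lp.coeFn_zero ℂ 2 AddCircle.haarAddCircle
    rw [map_zero]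
    filter_upwards [h.blockFourier_mulVec c, hu, h0,
      Lp.coeFn_zero ℂ 2 (AddCircle.haarAddCircle : Measure UnitAddCircle)] with t h1 h2 h3 h4
    rw [h4]
    have h5 := congr_arg (symbolMatrix Ψ t)⁻¹.mulVec h1
    rw [Matrix.mulVec_mulVec, Matrix.nonsing_inv_mul _ h2, Matrix.one_mulVec,
      show (fun i => blockFourier i (T c) t) = 0 from funext h3, Matrix.mulVec_zero] at h5
    exact (congr_fun h5 j).symm
  have hsurj : Function.Surjective T := by
    intro y
    -- The entries of the inverse are essentially bounded, so the candidate preimage stays in L².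
    have hmem : ∀ j, MemLp (fun t => ∑ i, (symbolMatrix Ψ t)⁻¹ j i * blockFourier i y t) 2
        (AddCircle.haarAddCircle : Measure UnitAddCircle) := fun j =>
      memLp_finsetSum _ fun i _ => (Lp.memLp (blockFourier i y)).mul (h.memLp_inv hm hdet j i)
    obtain ⟨c, hc⟩ := exists_blockFourier_eq fun j => (hmem j).toLp
    refine ⟨c, blockFourier_ext fun i => Lp.ext ?_⟩
    have h0 : ∀ᵐ t ∂AddCircle.haarAddCircle, ∀ j, blockFourier j c t =
        ((symbolMatrix Ψ t)⁻¹.mulVec fun i => blockFourier i y t) j :=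
      ae_all_iff.2 fun j => by rw [hc]; exact MemLp.coeFn_toLp _
    filter_upwards [h.blockFourier_mulVec c, hu, h0] with t h1 h2 h3
    rw [show (fun j => blockFourier j c t) = _ from funext h3, Matrix.mulVec_mulVec,
      Matrix.mul_nonsing_inv _ h2, Matrix.one_mulVec] at h1
    exact congr_fun h1 i
  rw [ContinuousLinearMap.isUnit_iff_bijective]
  exact ⟨hinj, hsurj⟩

/-- The matrix entries of the inverse are Fourier coefficients of the inverse of the symbol. -/
theorem HasSymbol.inverse_single (h : HasSymbol T Ψ) {m : ℝ} (hm : 0 < m)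
    (hdet : ∀ᵐ t ∂AddCircle.haarAddCircle, m ≤ ‖(symbolMatrix Ψ t).det‖) (i j : Fin ρ) (l k : ℤ)
    {c : BlockSeqL2 ρ} (hc : T c = lp.single 2 (i, l) 1) :
    c (j, k) = fourierCoeff (fun t => (symbolMatrix Ψ t)⁻¹ j i) (k - l) := by
  rw [← fourierCoeff_blockFourier, ← fourierCoeff_fourier_mul]
  refine congr_fun (fourierCoeff_congr_ae ?_) k
  have hu : ∀ᵐ t ∂AddCircle.haarAddCircle, IsUnit (symbolMatrix Ψ t).det :=
    hdet.mono fun t ht => isUnit_iff_ne_zero.2 fun h0 => by simp [h0] at ht; linarith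
  have h0 : ∀ᵐ t ∂AddCircle.haarAddCircle, ∀ i', blockFourier i' (T c) t =
      (Pi.single i (fourier l t) : Fin ρ → ℂ) i' := ae_all_iff.2 fun i' => by
    rw [hc, DerivSampling.blockFourier_single]
    split_ifs with hi
    · subst hi
      simp only [Pi.single_eq_same]
      exact coeFn_fourierLp (T := 1) 2 l
    · simp only [Pi.single_eq_of_ne hi]
      exact Lp.coeFn_zero ℂ 2 (AddCircle.haarAddCircle : Measure UnitAddCircle)
  filter_upwards [h.blockFourier_mulVec c, hu, h0] with t h1 h2 h3
  have h5 := congr_arg (symbolMatrix Ψ t)⁻¹.mulVec h1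
  rw [Matrix.mulVec_mulVec, Matrix.nonsing_inv_mul _ h2, Matrix.one_mulVec, funext h3] at h5
  have := congr_fun h5 j
  simp only [Matrix.mulVec_single] at this
  simpa [mul_comm] using this.symm

end Symbol

/-! ### Decay and termwise differentiation -/

section Decay

theorem exists_norm_le_of_isBigO {g : ℝ → ℂ} (hg : Continuous g) {p : ℝ} (hp : 0 ≤ p)
    (htop : g =O[atTop] fun t : ℝ => |t| ^ (-p)) (hbot : g =O[atBot] fun t : ℝ => |t| ^ (-p)) :
    ∃ C : ℝ, 0 ≤ C ∧ ∀ t, ‖g t‖ ≤ C * (1 + |t|) ^ (-p) := by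
  obtain ⟨c₁, h₁⟩ := htop.bound
  obtain ⟨c₂, h₂⟩ := hbot.bound
  obtain ⟨N₁, h₁⟩ := eventually_atTop.1 h₁
  obtain ⟨N₂, h₂⟩ := eventually_atBot.1 h₂
  set N := max 1 (max |N₁| |N₂|)
  obtain ⟨c₃, h₃⟩ := (isCompact_Icc (a := -N) (b := N)).exists_bound_of_continuousOn hg.continuousOn
  -- For |t| ≥ 1 one has 1 + |t| ≤ 2|t|, which costs the factor 2^p. The bound `c` may be negative,
  -- hence |c|.
  have hfar : ∀ {c t : ℝ}, 1 ≤ |t| → ‖g t‖ ≤ c * ‖|t| ^ (-p)‖ →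
      ‖g t‖ ≤ |c| * 2 ^ p * (1 + |t|) ^ (-p) := by
    intro c t ht h
    refine h.trans ?_
    rw [Real.norm_of_nonneg (by positivity), mul_assoc]
    refine mul_le_mul (le_abs_self c) ?_ (by positivity) (abs_nonneg _)
    have h0 : 0 < |t| := by linarith
    calc |t| ^ (-p) = 2 ^ p * (2 * |t|) ^ (-p) := by
          rw [Real.mul_rpow (by norm_num) h0.le, ← mul_assoc, ← Real.rpow_add (by norm_num)]
          simp
      _ ≤ 2 ^ p * (1 + |t|) ^ (-p) := by
          refine mul_le_mul_of_nonneg_left ?_ (by positivity)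
          exact Real.rpow_le_rpow_of_nonpos (by positivity) (by linarith) (by linarith)
  have hnear : ∀ t, |t| ≤ N → ‖g t‖ ≤ |c₃| * (1 + N) ^ p * (1 + |t|) ^ (-p) := by
    intro t ht
    have h1 : ‖g t‖ ≤ |c₃| := (h₃ t (abs_le.1 ht)).trans (le_abs_self _)
    rw [mul_assoc]
    refine h1.trans (le_mul_of_one_le_right (abs_nonneg _) ?_)
    rw [Real.rpow_neg (by positivity), ← div_eq_mul_inv, one_le_div (by positivity)]
    exact Real.rpow_le_rpow (by positivity) (by linarith) hp
  refine ⟨max (max (|c₁| * 2 ^ p) (|c₂| * 2 ^ p)) (|c₃| * (1 + N) ^ p),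
    le_max_of_le_left (le_max_of_le_left (by positivity)), fun t => ?_⟩
  have hN1 : 1 ≤ N := le_max_left _ _
  have hN2 : |N₁| ≤ N := (le_max_left _ _).trans (le_max_right _ _)
  have hN3 : |N₂| ≤ N := (le_max_right _ _).trans (le_max_right _ _)
  rcases le_or_gt |t| N with ht | ht
  · exact (hnear t ht).trans (mul_le_mul_of_nonneg_right (le_max_right _ _) (by positivity))
  · rcases lt_abs.1 ht with h | h
    · refine (hfar (hN1.trans ht.le) (h₁ t ?_)).trans (mul_le_mul_of_nonneg_right
        (le_max_of_le_left (le_max_left _ _)) (by positivity))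
      exact (le_abs_self _).trans (hN2.trans h.le)
    · refine (hfar (hN1.trans ht.le) (h₂ t ?_)).trans (mul_le_mul_of_nonneg_right
        (le_max_of_le_left (le_max_right _ _)) (by positivity))
      linarith [neg_abs_le N₂]

/-- The translates `g(x - k)` are dominated by a square summable sequence, locally uniformly
in `x`. -/
def LocallySquareSummable (g : ℝ → ℂ) : Prop :=
  ∀ R : ℝ, ∃ w : ℤ → ℝ, Summable (fun k => w k ^ 2) ∧ ∀ x, |x| ≤ R → ∀ k : ℤ, ‖g (x - k)‖ ≤ w k

/-- The dominating sequence comes from 1 + |k| ≤ (1 + |R|)(1 + |x - k|) for |x| ≤ R; its squares are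
summable because 2p > 1. -/
theorem locallySquareSummable_of_norm_le {g : ℝ → ℂ} {C p : ℝ} (hC : 0 ≤ C) (hp : 1 / 2 < p)
    (hg : ∀ t, ‖g t‖ ≤ C * (1 + |t|) ^ (-p)) : LocallySquareSummable g := by
  intro R
  refine ⟨fun k => C * (1 + |R|) ^ p * (1 + |(k : ℝ)|) ^ (-p), ?_, fun x hx k => ?_⟩
  · simp only [mul_pow _ ((1 + _ : ℝ) ^ (-p))]
    refine Summable.mul_left _ ?_
    have h0 : ∀ y : ℝ, 0 ≤ y → ((1 + y) ^ (-p)) ^ 2 ≤ y ^ (-(2 * p)) ∨ y = 0 := by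
      intro y hy
      rcases hy.eq_or_lt with h | h
      · exact Or.inr h.symm
      · left
        rw [← Real.rpow_natCast, ← Real.rpow_mul (by positivity)]
        rw [show -p * ((2 : ℕ) : ℝ) = -(2 * p) by push_cast; ring]
        exact Real.rpow_le_rpow_of_nonpos h (by linarith) (by linarith)
    have hs : Summable fun k : ℤ => |(k : ℝ)| ^ (-(2 * p)) :=
      Real.summable_abs_int_rpow (by linarith)
    refine Summable.of_norm_bounded_eventually hs ?_
    refine Filter.mem_of_superset (Set.Finite.compl_mem_cofinite (Set.finite_singleton (0 : ℤ))) ?_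
    intro k hk
    have hk0 : |(k : ℝ)| ≠ 0 := by simpa using hk
    change ‖_‖ ≤ _
    rw [Real.norm_of_nonneg (by positivity)]
    exact (h0 _ (abs_nonneg _)).resolve_right hk0
  · refine (hg _).trans ?_
    change _ ≤ C * (1 + |R|) ^ p * (1 + |(k : ℝ)|) ^ (-p)
    rw [mul_assoc]
    refine mul_le_mul_of_nonneg_left ?_ hC
    rw [Real.rpow_neg (by positivity), Real.rpow_neg (by positivity), ← div_eq_mul_inv,
      inv_eq_one_div, div_le_div_iff₀ (by positivity) (by positivity), one_mul,
      ← Real.mul_rpow (by positivity) (by positivity)]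
    refine Real.rpow_le_rpow (by positivity) ?_ (by linarith)
    have h1 : |(k : ℝ)| ≤ |x| + |x - k| := by
      have := abs_sub x (x - k); simpa using this
    have h2 : |x| ≤ |R| := hx.trans (le_abs_self R)
    nlinarith [abs_nonneg (x - k), abs_nonneg R]

theorem IsRegularStableGenerator.locallySquareSummable {r : ℕ} {φ : ℝ → ℂ}
    (h : IsRegularStableGenerator r φ) {s : ℕ} (hs : s ≤ r) :
    LocallySquareSummable (iteratedDeriv s φ) := by
  obtain ⟨ε, hε, hdec⟩ := h.decay
  obtain ⟨h1, h2⟩ := hdec s hs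
  rw [show -(1 / 2 : ℝ) - ε = -(1 / 2 + ε) by ring] at h1 h2
  obtain ⟨C, hC, hb⟩ := exists_norm_le_of_isBigO
    (h.contDiff.continuous_iteratedDeriv s (by exact_mod_cast hs)) (by positivity) h1 h2
  exact locallySquareSummable_of_norm_le hC (by linarith) hb

theorem LocallySquareSummable.summable_sq {g : ℝ → ℂ} (h : LocallySquareSummable g) (x : ℝ) :
    Summable fun k : ℤ => ‖g (x - k)‖ ^ 2 := by
  obtain ⟨w, hw, hb⟩ := h |x|
  refine hw.of_nonneg_of_le (fun k => by positivity) fun k => ?_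
  exact pow_le_pow_left₀ (norm_nonneg _) (hb x le_rfl k) 2

theorem LocallySquareSummable.summable_mul {g : ℝ → ℂ} (h : LocallySquareSummable g) (c : SeqL2)
    (x : ℝ) : Summable fun k : ℤ => c k * g (x - k) :=
  summable_mul_of_summable_sq (summable_norm_sq_lp c) (h.summable_sq x)

/-- On the unit ball about x the differentiated terms are dominated by ‖c k‖ w k, a product of two
square summable sequences. -/
theorem hasDerivAt_tsum_translates {g g' : ℝ → ℂ} (hd : ∀ x, HasDerivAt g (g' x) x)
    (hg : LocallySquareSummable g) (hg' : LocallySquareSummable g') (c : SeqL2) (x : ℝ) :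
    HasDerivAt (fun y => ∑' k : ℤ, c k * g (y - k)) (∑' k : ℤ, c k * g' (x - k)) x := by
  obtain ⟨w, hw, hb⟩ := hg' (|x| + 1)
  have hu : Summable fun k => ‖c k‖ * w k := by
    refine Summable.of_norm_bounded ((summable_norm_sq_lp c).add hw) fun k => ?_
    rw [norm_mul, norm_norm, Real.norm_eq_abs, ← sq_abs (w k)]
    nlinarith [sq_nonneg (‖c k‖ - |w k|), sq_nonneg ‖c k‖, sq_nonneg |w k|]
  have hx : x ∈ Metric.ball x 1 := Metric.mem_ball_self one_pos
  refine hasDerivAt_tsum_of_isPreconnected (g := fun (k : ℤ) y => c k * g (y - k))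
    (g' := fun (k : ℤ) y => c k * g' (y - k)) hu Metric.isOpen_ball
    (convex_ball x 1).isPreconnected (fun k y _ => ?_) (fun k y hy => ?_) hx
    (hg.summable_mul c x) hx
  · exact (HasDerivAt.comp_sub_const y (k : ℝ) (hd (y - k))).const_mul (c k)
  · rw [norm_mul]
    refine mul_le_mul_of_nonneg_left (hb y ?_ k) (norm_nonneg _)
    rw [Metric.mem_ball, Real.dist_eq] at hy
    have := abs_sub_abs_le_abs_sub y x
    linarith

theorem iteratedDeriv_tsum_translates {r : ℕ} {φ : ℝ → ℂ} (hφ : ContDiff ℝ r φ)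
    (hl : ∀ s ≤ r, LocallySquareSummable (iteratedDeriv s φ)) (c : SeqL2) {s : ℕ} (hs : s ≤ r) :
    iteratedDeriv s (fun x => ∑' k : ℤ, c k * φ (x - k)) =
      fun x => ∑' k : ℤ, c k * iteratedDeriv s φ (x - k) := by
  induction s with
  | zero => simp
  | succ s ih =>
    rw [iteratedDeriv_succ, ih (by omega)]
    ext x
    refine (hasDerivAt_tsum_translates (fun y => ?_) (hl s (by omega)) (hl (s + 1) hs) c x).deriv
    rw [iteratedDeriv_succ]
    exact (hφ.differentiable_iteratedDeriv s (by exact_mod_cast hs)).differentiableAt.hasDerivAt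

end Decay

/-! ### The Riesz basis of translates -/

section Riesz

/-- Convergence in L² gives almost everywhere convergence along a sequence of partial sums, where
the limit must agree with the pointwise sum. -/
theorem ae_eq_of_hasSum_translateLp {φ : ℝ → ℂ} (h : MemLp φ 2 volume) {d : SeqL2}
    {F : Lp ℂ 2 (volume : Measure ℝ)} (hF : HasSum (fun n : ℤ => d n • translateLp h n) F)
    {f : ℝ → ℂ} (hf : ∀ x : ℝ, HasSum (fun k : ℤ => d k * φ (x - k)) (f x)) :
    F =ᵐ[volume] f := by
  obtain ⟨ns, hns, hlim⟩ := (tendstoInMeasure_of_tendsto_Lp hF).exists_seq_tendsto_ae'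
  have hpart : ∀ s : Finset ℤ, (∑ n ∈ s, d n • translateLp h n : Lp ℂ 2 (volume : Measure ℝ))
      =ᵐ[volume] fun x => ∑ n ∈ s, d n * φ (x - n) := fun s => by
    have h1 := Lp.coeFn_fun_finsetSum s fun n => d n • translateLp h n
    have h2 : ∀ᵐ x ∂volume, ∀ n : ℤ, (d n • translateLp h n : Lp ℂ 2 (volume : Measure ℝ)) x =
        d n * φ (x - n) := ae_all_iff.2 fun n => by
      filter_upwards [Lp.coeFn_smul (d n) (translateLp h n),
        (memLp_translate h n).coeFn_toLp] with x h3 h4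
      rw [h3, Pi.smul_apply, translateLp, h4, smul_eq_mul]
    filter_upwards [h1, h2] with x h3 h4
    rw [h3]
    exact Finset.sum_congr rfl fun n _ => h4 n
  filter_upwards [hlim, ae_all_iff.2 hpart] with x h1 h2
  refine tendsto_nhds_unique h1 ?_
  simp only [h2]
  exact (hf x).comp hns

theorem IsStableGenerator.exists_bounds {φ : ℝ → ℂ} (h : IsStableGenerator φ) :
    ∃ A B : ℝ, 0 < A ∧ 0 < B ∧ ∀ (d : SeqL2) (f : ℝ → ℂ),
      (∀ x : ℝ, HasSum (fun k : ℤ => d k * φ (x - k)) (f x)) →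
      MemLp f 2 volume ∧ A * ‖d‖ ^ 2 ≤ (eLpNorm f 2 volume).toReal ^ 2 ∧
        (eLpNorm f 2 volume).toReal ^ 2 ≤ B * ‖d‖ ^ 2 := by
  obtain ⟨hm, -, A, B, hA, hAB, hd⟩ := h
  refine ⟨A, B, hA, hA.trans_le hAB, fun d f hf => ?_⟩
  obtain ⟨F, hF, h1, h2⟩ := hd d
  have hae := ae_eq_of_hasSum_translateLp hm hF hf
  rw [← norm_sq_eq_tsum_lp, Lp.norm_def, eLpNorm_congr_ae hae] at h1 h2
  exact ⟨(Lp.memLp F).ae_eq hae, h1, h2⟩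

variable {ρ : ℕ} [NeZero ρ]

/-- The bijection `ρ k + j ↦ (j, k)`. -/
def blockEquiv (ρ : ℕ) [NeZero ρ] : ℤ ≃ Fin ρ × ℤ :=
  (Int.divModEquiv ρ).trans (Equiv.prodComm _ _)

theorem blockEquiv_symm_apply (p : Fin ρ × ℤ) :
    (((blockEquiv ρ).symm p : ℤ) : ℝ) = ρ * (p.2 : ℝ) + ((p.1 : ℕ) : ℝ) := by
  simp [blockEquiv, Int.divModEquiv, mul_comm]

/-- The function `∑ c (j, k) φ(x - ρ k - j)`. -/
def blockSynth (φ : ℝ → ℂ) (c : BlockSeqL2 ρ) (x : ℝ) : ℂ :=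
  ∑' k : ℤ, lpComp (blockEquiv ρ) (blockEquiv ρ).injective c k * φ (x - k)

theorem hasSum_block_iff (g : ℝ → ℂ) (c : BlockSeqL2 ρ) (x : ℝ) (z : ℂ) :
    HasSum (fun p : Fin ρ × ℤ => c p * g (x - ρ * (p.2 : ℝ) - ((p.1 : ℕ) : ℝ))) z ↔
      HasSum (fun k : ℤ => lpComp (blockEquiv ρ) (blockEquiv ρ).injective c k * g (x - k)) z := by
  rw [← (blockEquiv ρ).symm.hasSum_iff]
  refine iff_of_eq (congr_arg (HasSum · z) (funext fun p => ?_))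
  simp [blockEquiv_symm_apply, sub_sub]

theorem LocallySquareSummable.summable_block {g : ℝ → ℂ} (h : LocallySquareSummable g) (x : ℝ) :
    Summable fun p : Fin ρ × ℤ => ‖g (x - ρ * (p.2 : ℝ) - ((p.1 : ℕ) : ℝ))‖ ^ 2 := by
  refine ((blockEquiv ρ).symm.summable_iff.2 (h.summable_sq x)).congr fun p => ?_
  simp [blockEquiv_symm_apply, sub_sub]

variable {r : ℕ} {φ : ℝ → ℂ}

theorem IsRegularStableGenerator.hasSum_translates (h : IsRegularStableGenerator r φ) (d : SeqL2)
    (x : ℝ) : HasSum (fun k : ℤ => d k * φ (x - k)) (∑' k : ℤ, d k * φ (x - k)) := by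
  have := h.locallySquareSummable (Nat.zero_le r)
  rw [iteratedDeriv_zero] at this
  exact (this.summable_mul d x).hasSum

theorem IsRegularStableGenerator.blockSynth_mem (h : IsRegularStableGenerator r φ)
    (c : BlockSeqL2 ρ) : blockSynth φ c ∈ shiftInvariantSpace φ := by
  obtain ⟨A, B, -, -, hAB⟩ := h.stable.exists_bounds
  exact ⟨(hAB _ _ (h.hasSum_translates _)).1, _, h.hasSum_translates _⟩

theorem exists_eq_blockSynth {f : ℝ → ℂ} (hf : f ∈ shiftInvariantSpace φ) :
    ∃ c : BlockSeqL2 ρ, f = blockSynth φ c := by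
  obtain ⟨-, d, hd⟩ := hf
  refine ⟨lpComp (blockEquiv ρ).symm (blockEquiv ρ).symm.injective d, funext fun x => ?_⟩
  rw [← (hd x).tsum_eq]
  simp [blockSynth]

variable (ρ) in
theorem IsRegularStableGenerator.exists_bounds (h : IsRegularStableGenerator r φ) :
    ∃ A B : ℝ, 0 < A ∧ 0 < B ∧ ∀ c : BlockSeqL2 ρ,
      A * ‖c‖ ^ 2 ≤ (eLpNorm (blockSynth φ c) 2 volume).toReal ^ 2 ∧
        (eLpNorm (blockSynth φ c) 2 volume).toReal ^ 2 ≤ B * ‖c‖ ^ 2 := by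
  obtain ⟨A, B, hA, hB, hAB⟩ := h.stable.exists_bounds
  refine ⟨A, B, hA, hB, fun c => ?_⟩
  have := (hAB _ _ (h.hasSum_translates (lpComp (blockEquiv ρ) (blockEquiv ρ).injective c))).2
  rwa [norm_lpComp_equiv] at this

theorem IsRegularStableGenerator.eq_zero_of_blockSynth (h : IsRegularStableGenerator r φ)
    {c : BlockSeqL2 ρ} (hc : blockSynth φ c = 0) : c = 0 := by
  obtain ⟨A, B, hA, -, hAB⟩ := h.exists_bounds ρ
  have := (hAB c).1
  rw [hc, eLpNorm_zero] at this
  have h0 : ‖c‖ ^ 2 ≤ 0 := by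
    by_contra hlt
    have := mul_pos hA (not_le.1 hlt)
    simp at *
    linarith
  simpa using le_antisymm h0 (by positivity)

theorem IsRegularStableGenerator.hasSum_iteratedDeriv_blockSynth
    (h : IsRegularStableGenerator r φ) {s : ℕ} (hs : s ≤ r) (c : BlockSeqL2 ρ) (x : ℝ) :
    HasSum (fun p : Fin ρ × ℤ => c p * iteratedDeriv s φ (x - ρ * (p.2 : ℝ) - ((p.1 : ℕ) : ℝ)))
      (iteratedDeriv s (blockSynth φ c) x) := by
  rw [hasSum_block_iff]
  unfold blockSynth
  rw [iteratedDeriv_tsum_translates h.contDiff (fun _ => h.locallySquareSummable) _ hs]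
  exact ((h.locallySquareSummable hs).summable_mul _ x).hasSum

theorem IsRegularStableGenerator.hasSum_blockSynth (h : IsRegularStableGenerator r φ)
    (c : BlockSeqL2 ρ) (x : ℝ) :
    HasSum (fun p : Fin ρ × ℤ => c p * φ (x - ρ * (p.2 : ℝ) - ((p.1 : ℕ) : ℝ)))
      (blockSynth φ c x) := by
  simpa using h.hasSum_iteratedDeriv_blockSynth (Nat.zero_le r) c x

end Riesz

/-! ### The sampling operator -/

section Sampling

theorem hasSum_fin_int {ρ : ℕ} {F : Fin ρ × ℤ → ℂ} {z : ℂ} (h : HasSum F z) :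
    HasSum (fun k : ℤ => ∑ j, F (j, k)) z := by
  have h' := (Equiv.prodComm ℤ (Fin ρ)).hasSum_iff.2 h
  exact h'.prod_fiberwise fun k => hasSum_fintype _

theorem tsum_enorm_sq_eq (r : ℕ) (s : ℕ → ℤ → ℂ) :
    ∑' n : ℤ, ∑ i ∈ Finset.range (r + 1), ‖s i n‖ₑ ^ 2 =
      ∑' p : Fin (r + 1) × ℤ, ‖s p.1 p.2‖ₑ ^ 2 := by
  rw [← (Equiv.prodComm ℤ (Fin (r + 1))).tsum_eq, ENNReal.tsum_prod']
  simp [Finset.sum_range, tsum_fintype]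

theorem enorm_sq_eq_ofReal (z : ℂ) : ‖z‖ₑ ^ 2 = ENNReal.ofReal (‖z‖ ^ 2) := by
  rw [ENNReal.ofReal_pow (norm_nonneg _), ofReal_norm]

theorem tsum_enorm_sq_lp {α : Type*} (c : lp (fun _ : α => ℂ) 2) :
    ∑' x, ‖c x‖ₑ ^ 2 = ENNReal.ofReal (‖c‖ ^ 2) := by
  rw [norm_sq_eq_tsum_lp, ENNReal.ofReal_tsum_of_nonneg (fun _ => by positivity)
    (summable_norm_sq_lp c)]
  simp only [enorm_sq_eq_ofReal]

theorem summable_norm_sq_of_tsum_enorm_ne_top {α : Type*} {c : α → ℂ}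
    (h : ∑' x, ‖c x‖ₑ ^ 2 ≠ ∞) : Summable fun x => ‖c x‖ ^ 2 := by
  simpa using ENNReal.summable_toReal h

theorem coe_mul_eLpNorm_sq {f : ℝ → ℂ} (hf : MemLp f 2 volume) (A : ℝ≥0) :
    (A : ℝ≥0∞) * eLpNorm f 2 volume ^ 2 =
      ENNReal.ofReal (A * (eLpNorm f 2 volume).toReal ^ 2) := by
  rw [ENNReal.ofReal_mul A.coe_nonneg, ENNReal.ofReal_pow ENNReal.toReal_nonneg,
    ENNReal.ofReal_toReal hf.eLpNorm_ne_top, ENNReal.ofReal_coe_nnreal]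

/-- Invertibility of the matrix can therefore be tested on whichever bounded operator realises it.
-/
theorem HasMatrix.unique {ρ : ℕ} {L : Matrix (Fin ρ × ℤ) (Fin ρ × ℤ) ℂ}
    {T T' : BlockSeqL2 ρ →L[ℂ] BlockSeqL2 ρ} (h : HasMatrix T L) (h' : HasMatrix T' L) :
    T = T' := by
  refine lp.ext_continuousLinearMap (by simp) fun q => ?_
  ext p
  simp only [ContinuousLinearMap.comp_apply, lp.singleContinuousLinearMap_apply]
  rw [h, h']

variable {r : ℕ} {φ : ℝ → ℂ} {a : ℝ}

theorem samplingMatrix_apply (ρ : ℕ) (p q : Fin ρ × ℤ) : samplingMatrix φ a ρ p q =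
    iteratedDeriv (p.1 : ℕ) φ (samplePoints a ρ p.2 - ρ * (q.2 : ℝ) - ((q.1 : ℕ) : ℝ)) := by
  unfold samplingMatrix samplePoints
  congr 1
  ring

theorem samplingMatrix_shift (ρ : ℕ) (i j : Fin ρ) (l k n : ℤ) :
    samplingMatrix φ a ρ (i, l - n) (j, k - n) = samplingMatrix φ a ρ (i, l) (j, k) := by
  simp [samplingMatrix]

theorem isBlockLaurent_samplingMatrix_iff {ρ : ℕ} : IsBlockLaurent (samplingMatrix φ a ρ) ↔
    ∃ T : BlockSeqL2 ρ →L[ℂ] BlockSeqL2 ρ, HasMatrix T (samplingMatrix φ a ρ) :=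
  ⟨And.right, fun h => ⟨samplingMatrix_shift ρ, h⟩⟩

theorem isInvertibleBlockLaurent_iff {ρ : ℕ} {T : BlockSeqL2 ρ →L[ℂ] BlockSeqL2 ρ}
    (hT : HasMatrix T (samplingMatrix φ a ρ)) :
    IsInvertibleBlockLaurent (samplingMatrix φ a ρ) ↔ IsUnit T := by
  refine ⟨fun ⟨_, T', hT', hu⟩ => ?_, fun hu =>
    ⟨isBlockLaurent_samplingMatrix_iff.2 ⟨T, hT⟩, T, hT, hu⟩⟩
  rwa [hT.unique hT']

/-- The entries of the symbol of the sampling matrix. -/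
abbrev samplingSymbol (φ : ℝ → ℂ) (a : ℝ) (ρ : ℕ) : Fin ρ → Fin ρ → CircleL2 :=
  symbolEntry φ a ρ

theorem IsRegularStableGenerator.fourierCoeff_symbolEntry (h : IsRegularStableGenerator r φ)
    (i j : Fin (r + 1)) (n : ℤ) : fourierCoeff (symbolEntry φ a (r + 1) i j) n =
      iteratedDeriv (i : ℕ) φ (a + (r + 1 : ℕ) * (n : ℝ) - ((j : ℕ) : ℝ)) := by
  have hl := (h.locallySquareSummable (Nat.lt_succ_iff.1 i.2)).summable_block (ρ := r + 1) a
  have hs : Summable fun k : ℤ =>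
      ‖iteratedDeriv (i : ℕ) φ (a + (r + 1 : ℕ) * (k : ℝ) - ((j : ℕ) : ℝ))‖ ^ 2 := by
    -- The square summable block family runs over a - ρk - j, whereas the symbol uses a + ρk - j;
    -- the sign of k is reversed.
    have hinj : Function.Injective fun k : ℤ => (j, -k) := fun _ _ hk =>
      neg_injective (Prod.mk.inj hk).2
    refine (hl.comp_injective hinj).congr fun k => ?_
    simp
  have hsum := (fourierBasis (T := 1)).hasSum_repr_symm (lpOfSummable _ hs)
  rw [coe_fourierBasis] at hsum
  have heq : symbolEntry φ a (r + 1) i j = (fourierBasis (T := 1)).repr.symm (lpOfSummable _ hs) :=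
    hsum.tsum_eq
  rw [heq, ← fourierBasis_repr, LinearIsometryEquiv.apply_symm_apply]
  rfl

variable {T : BlockSeqL2 (r + 1) →L[ℂ] BlockSeqL2 (r + 1)}

theorem IsRegularStableGenerator.hasSymbol (h : IsRegularStableGenerator r φ)
    (hT : HasMatrix T (samplingMatrix φ a (r + 1))) :
    HasSymbol T (samplingSymbol φ a (r + 1)) := by
  intro i j l k
  rw [hT, h.fourierCoeff_symbolEntry]
  simp [samplingMatrix]

theorem IsRegularStableGenerator.hasSum_samplingMatrix (h : IsRegularStableGenerator r φ)
    (c : BlockSeqL2 (r + 1)) (p : Fin (r + 1) × ℤ) :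
    HasSum (fun q => c q * samplingMatrix φ a (r + 1) p q)
      (iteratedDeriv (p.1 : ℕ) (blockSynth φ c) (samplePoints a (r + 1 : ℕ) p.2)) := by
  simp only [samplingMatrix_apply]
  exact h.hasSum_iteratedDeriv_blockSynth (Nat.lt_succ_iff.1 p.1.2) c _

/-- The sampling matrix maps the coefficients of a function to its samples. -/
theorem IsRegularStableGenerator.apply_eq_iteratedDeriv (h : IsRegularStableGenerator r φ)
    (hT : HasMatrix T (samplingMatrix φ a (r + 1))) (c : BlockSeqL2 (r + 1))
    (p : Fin (r + 1) × ℤ) :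
    T c p = iteratedDeriv (p.1 : ℕ) (blockSynth φ c) (samplePoints a (r + 1 : ℕ) p.2) := by
  -- Both sides are the sum of row `p` against `c`: the left by continuity of `T`, the right by
  -- termwise differentiation.
  have h1 := hasSum_apply_single (lp.evalCLM ℂ (fun _ : Fin (r + 1) × ℤ => ℂ) 2 p ∘L T) c
  have h2 : HasSum (fun q => c q * samplingMatrix φ a (r + 1) p q) (T c p) :=
    h1.congr_fun fun q => congr_arg (c q * ·) (hT p q).symm
  exact h2.unique (h.hasSum_samplingMatrix c p)

theorem IsRegularStableGenerator.tsum_samples_eq (h : IsRegularStableGenerator r φ)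
    (hT : HasMatrix T (samplingMatrix φ a (r + 1))) (c : BlockSeqL2 (r + 1)) :
    ∑' n : ℤ, ∑ i ∈ Finset.range (r + 1),
      ‖iteratedDeriv i (blockSynth φ c) (samplePoints a (r + 1 : ℕ) n)‖ₑ ^ 2 =
        ENNReal.ofReal (‖T c‖ ^ 2) := by
  rw [tsum_enorm_sq_eq r fun i n =>
    iteratedDeriv i (blockSynth φ c) (samplePoints a (r + 1 : ℕ) n), ← tsum_enorm_sq_lp]
  simp only [h.apply_eq_iteratedDeriv hT]

/-- The sampling map on coefficients is linear because each row acts by a convergent sum; the upper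
sampling inequality and the upper Riesz bound make it bounded. -/
theorem IsRegularStableGenerator.exists_hasMatrix (h : IsRegularStableGenerator r φ)
    (hi : IsStableSamplingSet φ r (samplePoints a (r + 1 : ℕ))) :
    ∃ T : BlockSeqL2 (r + 1) →L[ℂ] BlockSeqL2 (r + 1),
      HasMatrix T (samplingMatrix φ a (r + 1)) := by
  obtain ⟨A, B, -, -, hAB⟩ := hi
  obtain ⟨A', B', -, hB', hAB'⟩ := h.exists_bounds (r + 1)
  have hle : ∀ c : BlockSeqL2 (r + 1), ∑' p : Fin (r + 1) × ℤ,
      ‖iteratedDeriv (p.1 : ℕ) (blockSynth φ c) (samplePoints a (r + 1 : ℕ) p.2)‖ₑ ^ 2 ≤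
        ENNReal.ofReal (B * (eLpNorm (blockSynth φ c) 2 volume).toReal ^ 2) := fun c => by
    rw [← tsum_enorm_sq_eq r fun i n =>
      iteratedDeriv i (blockSynth φ c) (samplePoints a (r + 1 : ℕ) n),
      ← coe_mul_eLpNorm_sq (h.blockSynth_mem c).1]
    exact (hAB _ (h.blockSynth_mem c)).2
  have hs := fun c =>
    summable_norm_sq_of_tsum_enorm_ne_top ((hle c).trans_lt ENNReal.ofReal_lt_top).ne
  let S : BlockSeqL2 (r + 1) →ₗ[ℂ] BlockSeqL2 (r + 1) :=
    { toFun := fun c => lpOfSummable _ (hs c)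
      map_add' := fun c d => by
        ext p
        refine (h.hasSum_samplingMatrix (c + d) p).unique ?_
        refine ((h.hasSum_samplingMatrix c p).add (h.hasSum_samplingMatrix d p)).congr_fun
          fun q => ?_
        rw [lp.coeFn_add, Pi.add_apply, add_mul]
      map_smul' := fun z c => by
        ext p
        refine (h.hasSum_samplingMatrix (z • c) p).unique ?_
        refine ((h.hasSum_samplingMatrix c p).mul_left z).congr_fun fun q => ?_
        rw [lp.coeFn_smul, Pi.smul_apply, smul_eq_mul, mul_assoc] }
  have hS : ∀ c, ‖S c‖ ≤ √(B * B') * ‖c‖ := fun c => by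
    refine le_of_sq_le_sq ?_ (by positivity)
    have h1 := (tsum_enorm_sq_lp (S c)).symm.trans_le (hle c)
    rw [ENNReal.ofReal_le_ofReal_iff (by positivity)] at h1
    rw [mul_pow, Real.sq_sqrt (by positivity), mul_assoc]
    exact h1.trans (mul_le_mul_of_nonneg_left (hAB' c).2 B.coe_nonneg)
  refine ⟨S.mkContinuous _ hS, fun p q => ?_⟩
  refine (h.hasSum_samplingMatrix (lp.single 2 q 1) p).unique ?_
  convert hasSum_ite_eq q (samplingMatrix φ a (r + 1) p q) using 2 with q'
  rw [lp_single_apply_eq_ite]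
  split_ifs with hq
  · rw [hq, one_mul]
  · rw [zero_mul]

/-- Stable sampling means that the sampling matrix is bounded and bounded below. -/
theorem IsRegularStableGenerator.isStableSamplingSet_iff (h : IsRegularStableGenerator r φ)
    (hT : HasMatrix T (samplingMatrix φ a (r + 1))) :
    IsStableSamplingSet φ r (samplePoints a (r + 1 : ℕ)) ↔
      ∃ δ : ℝ, 0 < δ ∧ ∀ c, δ * ‖c‖ ≤ ‖T c‖ := by
  obtain ⟨A', B', hA', hB', hAB'⟩ := h.exists_bounds (r + 1)
  constructor
  · rintro ⟨A, B, hA, -, hAB⟩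
    have hA0 : (0 : ℝ) < A := hA
    refine ⟨√(A * A'), by positivity, fun c => le_of_sq_le_sq ?_ (norm_nonneg _)⟩
    have h1 := (hAB _ (h.blockSynth_mem c)).1
    rw [coe_mul_eLpNorm_sq (h.blockSynth_mem c).1, h.tsum_samples_eq hT,
      ENNReal.ofReal_le_ofReal_iff (by positivity)] at h1
    rw [mul_pow, Real.sq_sqrt (by positivity), mul_assoc]
    exact (mul_le_mul_of_nonneg_left (hAB' c).1 hA0.le).trans h1
  · rintro ⟨δ, hδ, hle⟩
    -- The Riesz bounds convert coefficient norms to L² norms. Adding 1 keeps the upper constant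
    -- positive even if `T` vanishes.
    refine ⟨(δ ^ 2 / B').toNNReal, ((‖T‖ ^ 2 + 1) / A').toNNReal,
      Real.toNNReal_pos.2 (by positivity), Real.toNNReal_pos.2 (by positivity), fun f hf => ?_⟩
    obtain ⟨c, rfl⟩ := exists_eq_blockSynth (ρ := r + 1) hf
    rw [coe_mul_eLpNorm_sq hf.1, coe_mul_eLpNorm_sq hf.1, h.tsum_samples_eq hT,
      Real.coe_toNNReal _ (by positivity), Real.coe_toNNReal _ (by positivity)]
    refine ⟨ENNReal.ofReal_le_ofReal ?_, ENNReal.ofReal_le_ofReal ?_⟩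
    · rw [div_mul_eq_mul_div, div_le_iff₀ hB']
      have h1 := pow_le_pow_left₀ (by positivity) (hle c) 2
      have h2 := mul_le_mul_of_nonneg_left (hAB' c).2 (sq_nonneg δ)
      nlinarith
    · rw [div_mul_eq_mul_div, le_div_iff₀ hA']
      have h1 := pow_le_pow_left₀ (norm_nonneg _) (T.le_opNorm c) 2
      have h2 := mul_le_mul_of_nonneg_left (hAB' c).1 (show 0 ≤ ‖T‖ ^ 2 + 1 by positivity)
      nlinarith [mul_nonneg hA'.le (sq_nonneg ‖c‖), mul_le_mul_of_nonneg_left h1 hA'.le]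

/-- Uniqueness is injectivity and interpolation is surjectivity of `T`; the open mapping theorem
supplies the bounded inverse. -/
theorem IsRegularStableGenerator.isCompleteInterpolationSet_iff
    (h : IsRegularStableGenerator r φ) (hT : HasMatrix T (samplingMatrix φ a (r + 1))) :
    IsCompleteInterpolationSet φ r (samplePoints a (r + 1 : ℕ)) ↔ IsUnit T := by
  rw [ContinuousLinearMap.isUnit_iff_bijective]
  refine and_congr ?_ ?_
  · rw [injective_iff_map_eq_zero]
    constructor
    · intro hU c hc
      refine h.eq_zero_of_blockSynth (hU _ (h.blockSynth_mem c) fun n i hi => ?_)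
      have := h.apply_eq_iteratedDeriv hT c (⟨i, Nat.lt_succ_iff.2 hi⟩, n)
      rw [← this, hc]
      rfl
    · intro hinj f hf h0
      obtain ⟨c, rfl⟩ := exists_eq_blockSynth (ρ := r + 1) hf
      have : c = 0 := hinj c (by
        ext p
        rw [h.apply_eq_iteratedDeriv hT]
        exact h0 p.2 p.1 (Nat.lt_succ_iff.1 p.1.2))
      subst this
      ext x
      simp [blockSynth]
  · constructor
    · intro hI y
      have hs : Summable fun p : ℤ × Fin (r + 1) => ‖y (p.2, p.1)‖ ^ 2 :=
        (Equiv.prodComm ℤ (Fin (r + 1))).summable_iff (f := fun p => ‖y p‖ ^ 2) |>.2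
          (summable_norm_sq_lp y)
      obtain ⟨f, hf, hfy⟩ := hI _ hs
      obtain ⟨c, rfl⟩ := exists_eq_blockSynth (ρ := r + 1) hf
      refine ⟨c, ?_⟩
      ext p
      rw [h.apply_eq_iteratedDeriv hT]
      exact hfy p.2 p.1
    · intro hsurj y hy
      have hs : Summable fun p : Fin (r + 1) × ℤ => ‖y (p.2, p.1)‖ ^ 2 :=
        (Equiv.prodComm (Fin (r + 1)) ℤ).summable_iff (f := fun p => ‖y p‖ ^ 2) |>.2 hy
      obtain ⟨c, hc⟩ := hsurj (lpOfSummable (fun p => y (p.2, p.1)) hs)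
      refine ⟨_, h.blockSynth_mem c, fun n i => ?_⟩
      have := h.apply_eq_iteratedDeriv hT c (i, n)
      rw [← this, hc]
      rfl

/-- Only the lower bound carries information: boundedness of `T` bounds the entries of the symbol,
hence its determinant. -/
theorem HasSymbol.symbolDetBounded_iff (hT : HasSymbol T (samplingSymbol φ a (r + 1))) :
    SymbolDetBounded φ a (r + 1) ↔ ∃ m : ℝ, 0 < m ∧ ∀ᵐ t ∂AddCircle.haarAddCircle,
      m ≤ ‖(symbolMatrix (samplingSymbol φ a (r + 1)) t).det‖ := by
  refine ⟨fun ⟨m, M, hm, _, hb⟩ => ⟨m, hm, hb.mono fun _ ht => ht.1⟩, fun ⟨m, hm, hb⟩ =>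
    ⟨m, (r + 1).factorial * ‖T‖ ^ (r + 1) + 1, hm, by positivity, ?_⟩⟩
  filter_upwards [hb, hT.norm_entry_le] with t h1 h2
  refine ⟨h1, ?_⟩
  have : ‖(symbolMatrix (samplingSymbol φ a (r + 1)) t).det‖ ≤ _ :=
    Matrix.det_le (abv := NormedField.toAbsoluteValue ℂ) h2
  simp only [Fintype.card_fin, nsmul_eq_mul] at this
  exact this.trans (by linarith)

theorem exists_le_norm_of_isUnit {E : Type*} [NormedAddCommGroup E] [NormedSpace ℂ E]
    {T : E →L[ℂ] E} (hT : IsUnit T) : ∃ δ : ℝ, 0 < δ ∧ ∀ c, δ * ‖c‖ ≤ ‖T c‖ := by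
  obtain ⟨u, rfl⟩ := hT
  let S : E →L[ℂ] E := ↑u⁻¹
  refine ⟨(‖S‖ + 1)⁻¹, by positivity, fun c => ?_⟩
  rw [inv_mul_le_iff₀ (by positivity)]
  have h1 : S ((u : E →L[ℂ] E) c) = c := by
    rw [← mul_apply_eq_comp, Units.inv_mul, one_apply_eq_self]
  have h2 := S.le_opNorm ((u : E →L[ℂ] E) c)
  rw [h1] at h2
  nlinarith [norm_nonneg ((u : E →L[ℂ] E) c)]

theorem IsRegularStableGenerator.tfae (h : IsRegularStableGenerator r φ)
    (hT : HasMatrix T (samplingMatrix φ a (r + 1))) :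
    List.TFAE [
      IsStableSamplingSet φ r (samplePoints a (r + 1 : ℕ)),
      IsInvertibleBlockLaurent (samplingMatrix φ a (r + 1)),
      SymbolDetBounded φ a (r + 1),
      IsCompleteInterpolationSet φ r (samplePoints a (r + 1 : ℕ))] := by
  have hΨ := h.hasSymbol hT
  rw [h.isStableSamplingSet_iff hT, isInvertibleBlockLaurent_iff hT,
    h.isCompleteInterpolationSet_iff hT, hΨ.symbolDetBounded_iff]
  tfae_have 1 → 3 := fun ⟨δ, hδ, hle⟩ => hΨ.exists_le_norm_det hδ hle
  tfae_have 3 → 2 := fun ⟨m, hm, hdet⟩ => hΨ.isUnit hm hdet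
  tfae_have 2 → 1 := exists_le_norm_of_isUnit
  tfae_have 2 ↔ 4 := Iff.rfl
  tfae_finish

/-- The reconstruction functions are the images under synthesis of the columns of the inverse of
the sampling matrix. -/
theorem IsRegularStableGenerator.hasSum_reconstructionTerm (h : IsRegularStableGenerator r φ)
    (hT : HasMatrix T (samplingMatrix φ a (r + 1))) {m : ℝ} (hm : 0 < m)
    (hdet : ∀ᵐ t ∂AddCircle.haarAddCircle,
      m ≤ ‖(symbolMatrix (samplingSymbol φ a (r + 1)) t).det‖)
    {i : Fin (r + 1)} {l : ℤ} {c : BlockSeqL2 (r + 1)} (hc : T c = lp.single 2 (i, l) 1) (t : ℝ) :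
    HasSum (reconstructionTerm φ a (r + 1) i (t - (r + 1 : ℕ) * (l : ℝ))) (blockSynth φ c t) := by
  -- The substitution v = k - l makes the series of the shifted reconstruction function match column
  -- (i, l) of the inverse.
  rw [← (Equiv.subRight l).hasSum_iff]
  refine (hasSum_fin_int (h.hasSum_blockSynth c t)).congr_fun fun k => ?_
  rw [Function.comp_apply, reconstructionTerm]
  refine Finset.sum_congr rfl fun j _ => ?_
  rw [(h.hasSymbol hT).inverse_single hm hdet i j l k hc]
  congr 2
  simp only [Equiv.subRight_apply]
  push_cast
  ring

theorem IsRegularStableGenerator.sampling_formula (h : IsRegularStableGenerator r φ)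
    (hi : IsStableSamplingSet φ r (samplePoints a (r + 1 : ℕ))) :
    (∀ i j : Fin (r + 1), Integrable (fun s : UnitAddCircle => (symbol φ a (r + 1) s)⁻¹ j i)
      AddCircle.haarAddCircle) ∧
    (∀ (i : Fin (r + 1)) (t : ℝ), Summable (reconstructionTerm φ a (r + 1) i t)) ∧
    ∀ f ∈ shiftInvariantSpace φ, ∀ t : ℝ,
      HasSum (fun l : ℤ => ∑ i : Fin (r + 1),
        iteratedDeriv (i : ℕ) f (a + (r + 1 : ℕ) * (l : ℝ)) *
          reconstructionFun φ a (r + 1) i (t - (r + 1 : ℕ) * (l : ℝ))) (f t) := by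
  obtain ⟨T, hT⟩ := h.exists_hasMatrix hi
  have hΨ := h.hasSymbol hT
  obtain ⟨δ, hδ, hle⟩ := (h.isStableSamplingSet_iff hT).1 hi
  obtain ⟨m, hm, hdet⟩ := hΨ.exists_le_norm_det hδ hle
  obtain ⟨u, rfl⟩ := hΨ.isUnit hm hdet
  set S : BlockSeqL2 (r + 1) →L[ℂ] BlockSeqL2 (r + 1) := ↑u⁻¹
  have hTS : ∀ y, (u : BlockSeqL2 (r + 1) →L[ℂ] BlockSeqL2 (r + 1)) (S y) = y := fun y => by
    rw [← mul_apply_eq_comp, Units.mul_inv, one_apply_eq_self]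
  have hST : ∀ y, S ((u : BlockSeqL2 (r + 1) →L[ℂ] BlockSeqL2 (r + 1)) y) = y := fun y => by
    rw [← mul_apply_eq_comp, Units.inv_mul, one_apply_eq_self]
  have hrec := fun i l t => h.hasSum_reconstructionTerm hT hm hdet (hTS (lp.single 2 (i, l) 1)) t
  refine ⟨fun i j => (hΨ.memLp_inv hm hdet j i).integrable le_top, fun i t => ?_, fun f hf t => ?_⟩
  · simpa using (hrec i 0 t).summable
  · obtain ⟨c, rfl⟩ := exists_eq_blockSynth (ρ := r + 1) hf
    have hl := h.locallySquareSummable (Nat.zero_le r)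
    rw [iteratedDeriv_zero] at hl
    have hP : ∀ d, lpPairingCLM _ (hl.summable_block t) d = blockSynth φ d t := fun d =>
      (hasSum_lpPairingCLM _ (hl.summable_block (ρ := r + 1) t) d).unique (h.hasSum_blockSynth d t)
    -- Synthesis at t is a continuous functional on ℓ², so its composition with the inverse may be
    -- applied termwise to the sample sequence. Convergence over the index set is unconditional,
    -- hence absolute in ℂ.
    have hsum := hasSum_apply_single (lpPairingCLM _ (hl.summable_block t) ∘L S)
      ((u : BlockSeqL2 (r + 1) →L[ℂ] BlockSeqL2 (r + 1)) c)
    simp only [ContinuousLinearMap.comp_apply, hST, hP] at hsum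
    refine (hasSum_fin_int hsum).congr_fun fun l => Finset.sum_congr rfl fun i _ => ?_
    rw [h.apply_eq_iteratedDeriv hT c (i, l), smul_eq_mul, ← (hrec i l t).tsum_eq]
    rfl

end Sampling

end DerivSampling

end

theorem theorem2p2 (ρ : ℕ) (hρ : 0 < ρ) (φ : ℝ → ℂ) (hφ : IsRegularStableGenerator (ρ - 1) φ)
    (a : ℝ) (ha : a ∈ Set.Ico (0 : ℝ) ρ) :
    -- (i) and (ii) are equivalent
    (IsStableSamplingSet φ (ρ - 1) (samplePoints a ρ) ↔
      IsInvertibleBlockLaurent (samplingMatrix φ a ρ)) ∧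
    -- all four conditions are equivalent, when `U_κ` is a (bounded) block Laurent operator
    (IsBlockLaurent (samplingMatrix φ a ρ) →
      List.TFAE [
        IsStableSamplingSet φ (ρ - 1) (samplePoints a ρ),
        IsInvertibleBlockLaurent (samplingMatrix φ a ρ),
        SymbolDetBounded φ a ρ,
        IsCompleteInterpolationSet φ (ρ - 1) (samplePoints a ρ)]) ∧
    -- in this case the sampling formula holds
    (IsStableSamplingSet φ (ρ - 1) (samplePoints a ρ) →
      (∀ i j : Fin ρ, Integrable (fun s : UnitAddCircle => (symbol φ a ρ s)⁻¹ j i)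
        AddCircle.haarAddCircle) ∧
      (∀ (i : Fin ρ) (t : ℝ), Summable (reconstructionTerm φ a ρ i t)) ∧
      ∀ f ∈ shiftInvariantSpace φ, ∀ t : ℝ,
        HasSum (fun l : ℤ => ∑ i : Fin ρ,
          iteratedDeriv (i : ℕ) f (a + ρ * (l : ℝ)) * reconstructionFun φ a ρ i (t - ρ * (l : ℝ)))
          (f t)) := by
  -- Writing ρ = r + 1 removes the truncated subtraction: derivatives up to order r give exactly ρ
  -- samples per point.
  obtain ⟨r, rfl⟩ : ∃ r, ρ = r + 1 := ⟨ρ - 1, by omega⟩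
  rw [Nat.add_sub_cancel] at hφ
  rw [Nat.add_sub_cancel]
  refine ⟨⟨fun hi => ?_, fun hii => ?_⟩, fun ⟨_, T, hT⟩ => hφ.tfae hT, fun hi =>
    hφ.sampling_formula hi⟩
  · obtain ⟨T, hT⟩ := hφ.exists_hasMatrix hi
    exact ((hφ.tfae hT).out 0 1).1 hi
  · obtain ⟨T, hT⟩ := hii.1.2
    exact ((hφ.tfae hT).out 0 1).2 hii
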